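/- Let $e$ be an even positive integer, $q=2^e$, and let $\mathbb F_q\subset\mathbb F_{q^2}$ be the finite fields of orders $q$ and $q^2$. Put $d=(q^2+q+1)/3$ and $\sigma(X)=X+X^d+X^{dq}\in\mathbb F_{q^2}[X]$. Then $\sigma$ permutes $\mathbb F_{q^2}$; write $\sigma^{-1}$ for the inverse permutation. For $\alpha\in\mathbb F_q^*$ define $$f_\alpha:\mathbb F_{q^2}\to\mathbb F_2,\qquad f_\alpha(x)=\operatorname{Tr}\bigl(\alpha\,(\sigma^{-1}(x))^3\bigr),$$ where $\operatorname{Tr}$ is the absolute trace from $\mathbb F_{q^2}$ to $\mathbb F_2$, and let $$W_{f_\alpha}(\beta)=\sum_{x\in\mathbb F_{q^2}}(-1)^{f_\alpha(x)+\operatorname{Tr}(\beta x)},\qquad \beta\in\mathbb F_{q^2},$$ be its Walsh transform. The multiplicity of a value $v$ is the number of $\beta\in\mathbb F_{q^2}$ with $W_{f_\alpha}(\beta)=v$. Then, for every $\alpha\in\mathbb F_q^*$: (a) If $\alpha$ is not a cube in $\mathbb F_q$, then $W_{f_\alpha}$ takes the value $q$ with multiplicity $q(q+1)/2$ and the value $-q$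 with multiplicity $q(q-1)/2$. (b) If $\alpha$ is a cube in $\mathbb F_q$ and $e=2$, then $W_{f_\alpha}$ takes the value $2q$ with multiplicity $3q/4$, the value $-2q$ with multiplicity $q/4$, and the value $0$ with multiplicity $q^2-q$. (c) If $\alpha$ is a cube in $\mathbb F_q$ and $e\ge 4$, then $W_{f_\alpha}$ takes the value $2q$ with multiplicity $q(q+2)/8$, the value $-2q$ with multiplicity $q(q-2)/8$, and the value $0$ with multiplicity $3q^2/4$. In each case the listed multiplicities add up to $q^2$, so no other value occurs. -/

import Mathlib

open Polynomial

noncomputable section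

/-- The exponent `d = (q² + q + 1) / 3`; the division is exact whenever `q ≡ 1 (mod 3)`,
in particular for `q = 2 ^ e` with `e` even. -/
def dExp (q : ℕ) : ℕ := (q ^ 2 + q + 1) / 3

/-- The polynomial `σ(X) = X + X ^ d + X ^ (d q)`, with coefficients in `K = 𝔽_{q²}`. -/
def sigmaPoly (K : Type*) [Field K] (q : ℕ) : K[X] :=
  X + X ^ dExp q + X ^ (dExp q * q)

/-- The map `x ↦ σ(x)` of `K` into itself. -/
def sigmaMap (K : Type*) [Field K] (q : ℕ) (x : K) : K := (sigmaPoly K q).eval x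

/-- The inverse map of `σ`; it is the two-sided inverse as soon as `σ` permutes `K`
(which is part of the theorem stated with it). -/
def sigmaInv (K : Type*) [Field K] (q : ℕ) : K → K := Function.invFun (sigmaMap K q)

/-- The Boolean function `f_α(x) = Tr(α (σ⁻¹(x))³)`, with `Tr` the absolute trace of `K`. -/
def fAlpha {F : Type*} (K : Type*) [Field F] [Field K] [Algebra F K] [Algebra (ZMod 2) K]
    (q : ℕ) (α : F) (x : K) : ZMod 2 :=
  Algebra.trace (ZMod 2) K (algebraMap F K α * sigmaInv K q x ^ 3)

/-- The Walsh transform `W_f(β) = ∑ₓ (-1) ^ (f(x) + Tr(β x))` of a Boolean function on `K`. -/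
def walsh {K : Type*} [Field K] [Fintype K] [Algebra (ZMod 2) K]
    (f : K → ZMod 2) (β : K) : ℤ :=
  ∑ x : K, (-1 : ℤ) ^ (f x + Algebra.trace (ZMod 2) K (β * x)).val

/-- The multiplicity with which the Walsh transform of `f` takes the value `v`. -/
def walshMult {K : Type*} [Field K] [Fintype K] [Algebra (ZMod 2) K]
    (f : K → ZMod 2) (v : ℤ) : ℕ :=
  Nat.card {β : K // walsh f β = v}

end

/-! Write χ for the trace character and x̄ for x^q. Substituting x = σ(y) turns W(β) into ∑ χ(αy³ +
βσ(y)). The map (i, z) ↦ εⁱz³, with ε a non-cube of 𝔽_q, is three-to-one onto K. After z = A + ω²Ā,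
with ω a primitive cube root of unity, the exponent has the same trace as aA⁸Ā + δA²Ā. Hence 3W(β)
is a sum of three quadratic sums (`three_mul_sum_eq_sum_quadSum`), each equal to q·zᵢ with zᵢ² the
size of its radical (`quadSum_sq`), and the radicals are zero sets of 𝔽₄-linear polynomials.

One matrix N governs all three radicals: the product of the twists by x ↦ x⁴ of a companion matrix.
With m = (q² - 1)/3 and ρ = ε^m, the i-th radical is nonzero iff Pᵢ = det(N + ρⁱ) vanishes
(`radCard_eq_one_iff_det_ne_zero`). A sesquilinear form preserved by N forces d·Pᵢ² = Pᵢ with d =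
det N (`det_frobProd_mul_sq`), and ∑ Pᵢ = 1 + d (`det_add_smul_one_sum`). As d = α^(-m) equals 1
exactly for cubes, the number of trivial radicals is even for cubes and odd otherwise. If two of the
Pᵢ vanish, the third radical has at most 4 elements (`radCard_le_four`). Together with 3 ∣ ∑ zᵢ,
this makes W/q odd for non-cubes and an element of {0, ±2} for cubes. The moments ∑ W = q² and ∑ W²
= q⁴ then fix all multiplicities. -/

/-- The canonical additive character `x ↦ (-1) ^ Tr x` with integer values. -/
noncomputable def traceChar {K : Type*} [Field K] [Algebra (ZMod 2) K] (x : K) : ℤ :=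
  (-1 : ℤ) ^ (Algebra.trace (ZMod 2) K x).val

/-! ### The additive character and its orthogonality. -/

section TraceChar

variable {K : Type*} [Field K] [Algebra (ZMod 2) K]

theorem neg_one_pow_val_add (a b : ZMod 2) :
    (-1 : ℤ) ^ (a + b).val = (-1) ^ a.val * (-1) ^ b.val := by
  revert a b; decide

theorem traceChar_add (x y : K) : traceChar (x + y) = traceChar x * traceChar y := by
  rw [traceChar, map_add, neg_one_pow_val_add]; rfl

theorem traceChar_zero : traceChar (0 : K) = 1 := by simp [traceChar]

theorem traceChar_mul_self (x : K) : traceChar x * traceChar x = 1 := by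
  rw [traceChar, ← pow_add, Even.neg_one_pow ⟨_, rfl⟩]

theorem traceChar_sq [Fintype K] [CharP K 2] (x : K) : traceChar (x ^ 2) = traceChar x := by
  have h := Algebra.trace_eq_of_algEquiv (FiniteField.frobeniusAlgEquivOfAlgebraic (ZMod 2) K) x
  rw [FiniteField.coe_frobeniusAlgEquivOfAlgebraic] at h
  simp only [ZMod.card] at h
  rw [traceChar, h, traceChar]

theorem traceChar_pow_two_pow [Fintype K] [CharP K 2] (x : K) (n : ℕ) :
    traceChar (x ^ 2 ^ n) = traceChar x := by
  induction n with
  | zero => simp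
  | succ n ih => rw [pow_succ, pow_mul, traceChar_sq, ih]

theorem sum_traceChar_mul [Fintype K] [DecidableEq K] (c : K) :
    ∑ x : K, traceChar (x * c) = if c = 0 then (Fintype.card K : ℤ) else 0 := by
  split_ifs with h
  · simp [h, traceChar_zero]
  -- Translation by y/c with Tr y = 1 flips the sign of every summand.
  · obtain ⟨y, hy⟩ := Algebra.trace_surjective (ZMod 2) K 1
    have hy' : traceChar (y * c⁻¹ * c) = -1 := by
      rw [inv_mul_cancel_right₀ h, traceChar, hy]; rfl
    have := Fintype.sum_equiv (Equiv.addRight (y * c⁻¹)) (fun x => traceChar ((x + y * c⁻¹) * c))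
      (fun x => traceChar (x * c)) (fun x => by simp)
    simp only [add_mul, traceChar_add, hy', mul_neg, mul_one, Finset.sum_neg_distrib] at this
    linarith

end TraceChar

/-! ### First and second moments of the Walsh transform. -/

section Parseval

variable {K : Type*} [Field K] [Fintype K] [Algebra (ZMod 2) K]

theorem walsh_eq (f : K → ZMod 2) (β : K) :
    walsh f β = ∑ x, (-1 : ℤ) ^ (f x).val * traceChar (x * β) := by
  simp only [walsh, neg_one_pow_val_add, traceChar, mul_comm β]

theorem sum_walsh (f : K → ZMod 2) :
    ∑ β, walsh f β = Fintype.card K * (-1 : ℤ) ^ (f 0).val := by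
  classical
  simp only [walsh_eq]
  rw [Finset.sum_comm]
  simp only [← Finset.mul_sum]
  have h (x : K) : ∑ β, traceChar (x * β) = if x = 0 then (Fintype.card K : ℤ) else 0 := by
    simpa only [mul_comm] using sum_traceChar_mul x
  simp [h, mul_comm]

theorem sum_walsh_sq (f : K → ZMod 2) [CharP K 2] :
    ∑ β, walsh f β ^ 2 = (Fintype.card K : ℤ) ^ 2 := by
  classical
  have h (β : K) : walsh f β ^ 2 = ∑ x, ∑ y,
      (-1 : ℤ) ^ (f x).val * (-1 : ℤ) ^ (f y).val * traceChar (β * (x + y)) := by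
    rw [walsh_eq, sq, Finset.sum_mul_sum]
    refine Finset.sum_congr rfl fun x _ => Finset.sum_congr rfl fun y _ => ?_
    rw [mul_comm β, add_mul, traceChar_add]; ring
  simp only [h]
  rw [Finset.sum_comm]
  have h2 (x : K) : ∑ β, ∑ y, (-1 : ℤ) ^ (f x).val * (-1 : ℤ) ^ (f y).val *
      traceChar (β * (x + y)) = Fintype.card K := by
    rw [Finset.sum_comm]
    simp only [← Finset.mul_sum, sum_traceChar_mul, CharTwo.add_eq_zero]
    simp [← pow_add, Even.neg_one_pow (Even.add_self _)]
  simp [h2, sq]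

end Parseval

/-! ### Cubes and cube roots of unity in a finite field. -/

section Cubes

theorem sq_add_self_add_one_of_pow_three {L : Type*} [Field L] {ρ : L} (h : ρ ^ 3 = 1)
    (h1 : ρ ≠ 1) :
    ρ ^ 2 + ρ + 1 = 0 := by
  have : (ρ - 1) * (ρ ^ 2 + ρ + 1) = 0 := by linear_combination h
  exact (mul_eq_zero.1 this).resolve_left (sub_ne_zero.2 h1)

theorem eq_or_eq_or_eq_of_pow_three {L : Type*} [Field L] {ρ x : L}
    (hρ : ρ ^ 2 + ρ + 1 = 0) (hx : x ^ 3 = 1) :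
    x = 1 ∨ x = ρ ∨ x = ρ ^ 2 := by
  have : (x - 1) * ((x - ρ) * (x - ρ ^ 2)) = 0 := by
    linear_combination hx - (x ^ 2 - x) * hρ + (ρ - 1) * hρ * (x - 1)
  simpa [sub_eq_zero] using this
variable {L : Type*} [Field L] [Fintype L]

theorem pow_eq_one_of_three_mul {m : ℕ} (hm : 3 * m + 1 = Fintype.card L) {z : L} (hz : z ≠ 0) :
    (z ^ 3) ^ m = 1 := by
  rw [← pow_mul, ← FiniteField.pow_card_sub_one_eq_one z hz, ← hm, Nat.add_sub_cancel]

theorem exists_pow_three_eq {m : ℕ} (hm : 3 * m + 1 = Fintype.card L) {c : L}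
    (hc : c ^ m = 1) : ∃ z, z ^ 3 = c := by
  have hm0 : 0 < m := by
    have := Fintype.one_lt_card (α := L); omega
  have hc0 : c ≠ 0 := by rintro rfl; simp [hm0.ne'] at hc
  obtain ⟨g, hg⟩ := IsCyclic.exists_generator (α := Lˣ)
  obtain ⟨k, hk⟩ := Submonoid.mem_powers_iff _ _ |>.1
    ((mem_powers_iff_mem_zpowers).2 (hg (Units.mk0 c hc0)))
  classical
  have ho : orderOf g = 3 * m := by
    rw [orderOf_eq_card_of_forall_mem_zpowers hg, Nat.card_eq_fintype_card, Fintype.card_units]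
    omega
  have h1 : g ^ (k * m) = 1 := by
    rw [pow_mul, hk]; ext; simpa using hc
  have h2 := orderOf_dvd_of_pow_eq_one h1
  rw [ho] at h2
  obtain ⟨j, rfl⟩ := Nat.dvd_of_mul_dvd_mul_right hm0 h2
  refine ⟨((g ^ j : Lˣ) : L), ?_⟩
  have := congrArg Units.val hk
  rw [← Units.val_pow_eq_pow_val, ← pow_mul, mul_comm j, hk, Units.val_mk0]

theorem exists_pow_ne_one {m : ℕ} (hm : 3 * m + 1 = Fintype.card L) :
    ∃ ε : L, ε ≠ 0 ∧ ε ^ m ≠ 1 := by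
  by_contra! h
  have hm0 : 0 < m := by
    have := Fintype.one_lt_card (α := L); omega
  obtain ⟨g, hg⟩ := IsCyclic.exists_generator (α := Lˣ)
  classical
  have ho : orderOf g = 3 * m := by
    rw [orderOf_eq_card_of_forall_mem_zpowers hg, Nat.card_eq_fintype_card, Fintype.card_units]
    omega
  have h1 : g ^ m = 1 := by ext; simpa using h g g.ne_zero
  have := Nat.le_of_dvd hm0 (orderOf_dvd_of_pow_eq_one h1)
  omega

variable [DecidableEq L]

/-- The map `(i, z) ↦ ε ^ i z ³` is three-to-one if `ε` is not a cube. -/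
theorem card_fiber_mul_pow_three {m : ℕ} (hm : 3 * m + 1 = Fintype.card L) {ε : L}
    (hε : ε ≠ 0) (hε1 : ε ^ m ≠ 1) (x : L) :
    (Finset.univ.filter fun p : Fin 3 × L => ε ^ (p.1 : ℕ) * p.2 ^ 3 = x).card = 3 := by
  have hρ3 : (ε ^ m) ^ 3 = 1 := by rw [← pow_mul, mul_comm, pow_mul, pow_eq_one_of_three_mul hm hε]
  set ρ := ε ^ m with hρdef
  have hρ := sq_add_self_add_one_of_pow_three hρ3 hε1
  have hρ0 : ρ ≠ 0 := pow_ne_zero _ hε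
  have hρ2 : ρ ^ 2 ≠ 1 := fun h => hε1 (by rw [pow_succ, h, one_mul] at hρ3; exact hρ3)
  have hρ12 : ρ ^ 2 ≠ ρ := fun h => hε1 (mul_left_cancel₀ hρ0 (by rw [mul_one, ← sq, h]))
  by_cases hx : x = 0
  · subst hx
    have : (Finset.univ.filter fun p : Fin 3 × L => ε ^ (p.1 : ℕ) * p.2 ^ 3 = 0)
        = Finset.univ ×ˢ {0} := by
      ext ⟨i, z⟩
      simpa [hε] using eq_comm
    rw [this, Finset.card_product]; simp
  · obtain ⟨i, z, hz⟩ : ∃ (i : Fin 3) (z : L), ε ^ (i : ℕ) * z ^ 3 = x := by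
      have hxm : (x ^ m) ^ 3 = 1 := by
        rw [← pow_mul, mul_comm, pow_mul, pow_eq_one_of_three_mul hm hx]
      obtain ⟨i, hi⟩ : ∃ i : Fin 3, x ^ m = ρ ^ (i : ℕ) := by
        rcases eq_or_eq_or_eq_of_pow_three hρ hxm with h | h | h
        · exact ⟨0, by simpa using h⟩
        · exact ⟨1, by simpa using h⟩
        · exact ⟨2, by simpa using h⟩
      obtain ⟨z, hz⟩ := exists_pow_three_eq hm (c := x / ε ^ (i : ℕ)) (by
        rw [div_pow, hi, hρdef, ← pow_mul, ← pow_mul, mul_comm m, div_self (pow_ne_zero _ hε)])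
      exact ⟨i, z, by rw [hz, mul_div_cancel₀ _ (pow_ne_zero _ hε)]⟩
    have hz0 : z ≠ 0 := by rintro rfl; exact hx (by simpa using hz.symm)
    have : (Finset.univ.filter fun p : Fin 3 × L => ε ^ (p.1 : ℕ) * p.2 ^ 3 = x)
        = ({(i, z), (i, ρ * z), (i, ρ ^ 2 * z)} : Finset (Fin 3 × L)) := by
      ext ⟨j, y⟩
      simp only [Finset.mem_filter, Finset.mem_univ, true_and, Finset.mem_insert,
        Finset.mem_singleton, Prod.mk.injEq]
      constructor
      · intro hy
        have hy0 : y ≠ 0 := by rintro rfl; exact hx (by simpa using hy.symm)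
        have hij : ρ ^ (j : ℕ) = ρ ^ (i : ℕ) := by
          have h := congrArg (· ^ m) (hy.trans hz.symm)
          simp only [mul_pow, pow_eq_one_of_three_mul hm hy0, pow_eq_one_of_three_mul hm hz0,
            mul_one, ← pow_mul] at h
          rw [hρdef, ← pow_mul, ← pow_mul, mul_comm m, mul_comm m, h]
        have hji : j = i := by
          have hρ2' := hρ2.symm; have hρ12' := hρ12.symm; have hε1' := hε1.symm
          fin_cases i <;> fin_cases j <;> simp_all
        subst hji
        have hyz : (y / z) ^ 3 = 1 := by
          rw [div_pow, mul_left_cancel₀ (pow_ne_zero _ hε) (hy.trans hz.symm),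
            div_self (pow_ne_zero _ hz0)]
        simpa [div_eq_iff hz0] using eq_or_eq_or_eq_of_pow_three hρ hyz
      · have h6 : (ρ ^ 2) ^ 3 = 1 := by rw [← pow_mul, mul_comm, pow_mul, hρ3, one_pow]
        rintro (⟨rfl, rfl⟩ | ⟨rfl, rfl⟩ | ⟨rfl, rfl⟩) <;> simp [mul_pow, hρ3, h6, hz]
    rw [this, Finset.card_eq_three]
    refine ⟨_, _, _, fun h => hε1 ?_, fun h => hρ2 ?_, fun h => hρ12 ?_, rfl⟩
    · exact mul_right_cancel₀ hz0 (((Prod.ext_iff.1 h).2).symm.trans (one_mul z).symm)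
    · exact mul_right_cancel₀ hz0 (((Prod.ext_iff.1 h).2).symm.trans (one_mul z).symm)
    · exact mul_right_cancel₀ hz0 ((Prod.ext_iff.1 h).2).symm

theorem sum_mul_pow_three {m : ℕ} (hm : 3 * m + 1 = Fintype.card L) {ε : L}
    (hε : ε ≠ 0) (hε1 : ε ^ m ≠ 1) (G : L → ℤ) :
    ∑ i : Fin 3, ∑ z, G (ε ^ (i : ℕ) * z ^ 3) = 3 * ∑ x, G x := by
  rw [← Fintype.sum_prod_type' (f := fun (i : Fin 3) z => G (ε ^ (i : ℕ) * z ^ 3)),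
    ← Finset.sum_fiberwise (g := fun p : Fin 3 × L => ε ^ (p.1 : ℕ) * p.2 ^ 3), Finset.mul_sum]
  refine Finset.sum_congr rfl fun x _ => ?_
  rw [Finset.sum_congr rfl (g := fun _ => G x) fun p hp => by rw [(Finset.mem_filter.1 hp).2],
    Finset.sum_const, card_fiber_mul_pow_three hm hε hε1]
  simp

end Cubes

/-! ### Conjugation over 𝔽_q and σ in cubic coordinates. -/

section HalfFrob

variable {K : Type*} [Field K] [CharP K 2]

/-- The map `x ↦ x ^ (2 ^ e)`; it is the conjugation of `K` over `𝔽_q` when `|K| = q²`,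
`q = 2 ^ e`. -/
def halfFrob (K : Type*) [Field K] [CharP K 2] (e : ℕ) : K →+* K := iterateFrobenius K 2 e

theorem halfFrob_apply (e : ℕ) (x : K) : halfFrob K e x = x ^ 2 ^ e := iterateFrobenius_def ..

/-- With q = 3k + 1 one has d = (q - 1)k + q, so d ≡ 1 modulo q - 1. -/
theorem pow_dExp_of_fixed {e k : ℕ} (hk : 2 ^ e = 3 * k + 1) {ε : K}
    (hε : halfFrob K e ε = ε) : ε ^ dExp (2 ^ e) = ε := by
  rw [halfFrob_apply] at hε
  have hd : dExp (2 ^ e) = 2 ^ e * k + (2 * k + 1) := by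
    rw [dExp]; apply Nat.div_eq_of_eq_mul_right (by norm_num); rw [hk]; ring
  rw [hd, pow_add, pow_mul, hε, ← pow_add, show k + (2 * k + 1) = 2 ^ e by omega, hε]

theorem three_mul_dExp {e k : ℕ} (hk : 2 ^ e = 3 * k + 1) :
    3 * dExp (2 ^ e) = (2 ^ e) ^ 2 + 2 ^ e + 1 := by
  refine Nat.mul_div_cancel' ⟨3 * k ^ 2 + 3 * k + 1, ?_⟩
  rw [hk]; ring

theorem sigmaMap_eq (e : ℕ) (x : K) :
    sigmaMap K (2 ^ e) x = x + x ^ dExp (2 ^ e) + halfFrob K e (x ^ dExp (2 ^ e)) := by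
  simp [sigmaMap, sigmaPoly, halfFrob_apply, ← pow_mul]

variable [Fintype K]

theorem halfFrob_halfFrob {e : ℕ} (hK : Fintype.card K = (2 ^ e) ^ 2) (x : K) :
    halfFrob K e (halfFrob K e x) = x := by
  rw [halfFrob_apply, halfFrob_apply, ← pow_mul, ← sq, ← hK, FiniteField.pow_card]

theorem halfFrob_bijective (e : ℕ) : Function.Bijective (halfFrob K e) :=
  Finite.injective_iff_bijective.1 (halfFrob K e).injective

theorem traceChar_halfFrob [Algebra (ZMod 2) K] (e : ℕ) (x : K) :
    traceChar (halfFrob K e x) = traceChar x := by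
  rw [halfFrob_apply, traceChar_pow_two_pow]

theorem mul_pow_three_pow_dExp {e k : ℕ} (hk : 2 ^ e = 3 * k + 1)
    (hK : Fintype.card K = (2 ^ e) ^ 2) {ε : K} (hε : halfFrob K e ε = ε) (z : K) :
    (ε * z ^ 3) ^ dExp (2 ^ e) = ε * z ^ 2 * halfFrob K e z := by
  have hz : z ^ (2 ^ e) ^ 2 = z := by rw [← hK, FiniteField.pow_card]
  rw [mul_pow, pow_dExp_of_fixed hk hε, ← pow_mul, three_mul_dExp hk, pow_succ, pow_add, hz,
    halfFrob_apply]
  ring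

/-- Since 3d = q² + q + 1, σ(εz³) = ε·z(z² + zz̄ + z̄²) = ε·z(z + ωz̄)(z + ω²z̄). For z = A + ω²Ā
the last two factors become Ā and ω²A. -/
theorem sigmaMap_mul_pow_three {e k : ℕ} (hk : 2 ^ e = 3 * k + 1)
    (hK : Fintype.card K = (2 ^ e) ^ 2) {ε ω : K} (hε : halfFrob K e ε = ε) (hω : ω ^ 2 + ω + 1 = 0)
    (hω' : halfFrob K e ω = ω) (A : K) :
    sigmaMap K (2 ^ e) (ε * (A + ω ^ 2 * halfFrob K e A) ^ 3)
      = ε * (A * halfFrob K e A * (ω ^ 2 * A + ω * halfFrob K e A)) := by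
  have h2 : (2 : K) = 0 := CharTwo.two_eq_zero
  rw [sigmaMap_eq, mul_pow_three_pow_dExp hk hK hε]
  simp only [map_mul, map_add, map_pow, hε, hω', halfFrob_halfFrob hK]
  generalize halfFrob K e A = B
  grind

end HalfFrob

/-! ### The map σ is a permutation. -/

section Bijective

variable {K : Type*} [Field K] [CharP K 2] [Fintype K]

theorem bijective_add_mul_halfFrob {e : ℕ} (hK : Fintype.card K = (2 ^ e) ^ 2) {ω : K}
    (hω : ω ^ 2 + ω + 1 = 0) (hω' : halfFrob K e ω = ω) :
    Function.Bijective fun A : K => A + ω ^ 2 * halfFrob K e A := by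
  have h2 : (2 : K) = 0 := CharTwo.two_eq_zero
  refine Finite.injective_iff_bijective.1 fun A B hAB => ?_
  have h := congrArg (halfFrob K e) hAB
  simp only [map_mul, map_add, map_pow, hω', halfFrob_halfFrob hK] at h hAB
  have hω0 : ω ≠ 0 := by rintro rfl; simp at hω
  refine mul_left_cancel₀ hω0 ?_
  generalize halfFrob K e A = A' at *
  generalize halfFrob K e B = B' at *
  grind

/-- The form y² + yȳ + ȳ² factors as (y + ωȳ)(y + ω²ȳ), and conjugating either linear equation makes
y a nontrivial cube root of unity times itself. -/
theorem eq_zero_of_norm_add_trace_sq {e : ℕ} {ω : K} (hK : Fintype.card K = (2 ^ e) ^ 2)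
    (hω : ω ^ 2 + ω + 1 = 0) (hω' : halfFrob K e ω = ω) {y : K}
    (h : y * halfFrob K e y + (y + halfFrob K e y) ^ 2 = 0) : y = 0 := by
  have h2 : (2 : K) = 0 := CharTwo.two_eq_zero
  have h1 : (y + ω * halfFrob K e y) * (y + ω ^ 2 * halfFrob K e y) = 0 := by
    generalize halfFrob K e y = z at *
    grind
  have hω0 : ω ≠ 0 := by rintro rfl; simp at hω
  rcases mul_eq_zero.1 h1 with h | h <;>
  · have h' := congrArg (halfFrob K e) h
    simp only [map_mul, map_add, map_pow, hω', halfFrob_halfFrob hK, map_zero] at h'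
    generalize halfFrob K e y = z at *
    grind

theorem sigmaMap_bijective {e k : ℕ} (hk : 2 ^ e = 3 * k + 1)
    (hK : Fintype.card K = (2 ^ e) ^ 2) {m : ℕ} (hm : 3 * m + 1 = Fintype.card K) {ε ω : K}
    (hε0 : ε ≠ 0) (hεm : ε ^ m ≠ 1) (hε : halfFrob K e ε = ε) (hω : ω ^ 2 + ω + 1 = 0)
    (hω' : halfFrob K e ω = ω) :
    Function.Bijective (sigmaMap K (2 ^ e)) := by
  classical
  have h2 : (2 : K) = 0 := CharTwo.two_eq_zero
  -- This is an explicit inverse: for y ≠ 0, x = y + Tr(y)N(y)/(N(y) + Tr(y)²), with relative trace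
  -- and norm over 𝔽_q.
  have key (x : K) (y t : K) (hy : y = sigmaMap K (2 ^ e) x) (ht : t = x + y) :
      t * (y * halfFrob K e y + (y + halfFrob K e y) ^ 2)
        = (y + halfFrob K e y) * (y * halfFrob K e y) ∧ (y = 0 → x = 0) := by
    obtain ⟨⟨i, z⟩, hp⟩ := Finset.card_pos.1
      (by rw [card_fiber_mul_pow_three hm hε0 hεm x]; norm_num)
    obtain ⟨A, rfl⟩ := (bijective_add_mul_halfFrob hK hω hω').2 z
    simp only [Finset.mem_filter, Finset.mem_univ, true_and] at hp
    subst hp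
    have hεi : halfFrob K e (ε ^ (i : ℕ)) = ε ^ (i : ℕ) := by rw [map_pow, hε]
    have hεi0 : ε ^ (i : ℕ) ≠ 0 := pow_ne_zero _ hε0
    rw [sigmaMap_mul_pow_three hk hK hεi hω hω'] at hy
    generalize ε ^ (i : ℕ) = δ at *
    have hyb := congrArg (halfFrob K e) hy
    simp only [map_mul, map_add, map_pow, hω', hεi, halfFrob_halfFrob hK] at hyb
    constructor
    · generalize halfFrob K e A = B at *
      rw [hyb, ht, hy]
      grind
    · rintro rfl
      have hω0 : ω ≠ 0 := by rintro rfl; simp at hω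
      have hA : A = 0 := by
        have h1 := (mul_eq_zero.1 hy.symm).resolve_left hεi0
        rcases mul_eq_zero.1 h1 with h | h
        · rcases mul_eq_zero.1 h with h | h
          · exact h
          · exact (map_eq_zero _).1 h
        · have h' := congrArg (halfFrob K e) h
          simp only [map_mul, map_add, map_pow, hω', halfFrob_halfFrob hK, map_zero] at h'
          generalize halfFrob K e A = B at *
          grind
      simp [hA]
  refine Finite.injective_iff_bijective.1 fun x x' hxx => ?_
  obtain ⟨h1, h1'⟩ := key x _ _ rfl rfl
  obtain ⟨h3, h3'⟩ := key x' _ _ rfl rfl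
  rw [← hxx] at h3 h3'
  by_cases hy : sigmaMap K (2 ^ e) x = 0
  · rw [h1' hy, h3' hy]
  · have hn := mt (eq_zero_of_norm_add_trace_sq hK hω hω') hy
    exact add_right_cancel (mul_right_cancel₀ hn (h1.trans h3.symm))

end Bijective

/-! ### Reduction of the Walsh sum to quadratic forms. -/

section QuadSum

variable {K : Type*} [Field K] [CharP K 2] [Fintype K] [Algebra (ZMod 2) K]

/-- The exponential sum of the quadratic form `Tr (a x⁸ x̄ + δ x² x̄)`. -/
noncomputable def quadSum (e : ℕ) (a δ : K) : ℤ :=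
  ∑ x : K, traceChar (a * x ^ 8 * halfFrob K e x + δ * x ^ 2 * halfFrob K e x)

theorem three_mul_sum_eq_sum_quadSum {e k : ℕ} (hk : 2 ^ e = 3 * k + 1)
    (hK : Fintype.card K = (2 ^ e) ^ 2) {m : ℕ} (hm : 3 * m + 1 = Fintype.card K) {ε ω α : K}
    (hε0 : ε ≠ 0) (hεm : ε ^ m ≠ 1) (hε : halfFrob K e ε = ε) (hω : ω ^ 2 + ω + 1 = 0)
    (hω' : halfFrob K e ω = ω) (hα : halfFrob K e α = α) (β : K) :
    3 * ∑ x, traceChar (α * x ^ 3 + β * sigmaMap K (2 ^ e) x) =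
      ∑ i : Fin 3, quadSum e (α * (ε ^ (i : ℕ)) ^ 3)
        (ε ^ (i : ℕ) * (ω ^ 2 * β + ω * halfFrob K e β)) := by
  classical
  have h2 : (2 : K) = 0 := CharTwo.two_eq_zero
  rw [← sum_mul_pow_three hm hε0 hεm]
  refine Finset.sum_congr rfl fun i _ => ?_
  have hεi : halfFrob K e (ε ^ (i : ℕ)) = ε ^ (i : ℕ) := by rw [map_pow, hε]
  generalize ε ^ (i : ℕ) = δ at *
  refine (Fintype.sum_bijective _ (bijective_add_mul_halfFrob hK hω hω') _ _ fun A => ?_).symm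
  rw [sigmaMap_mul_pow_three hk hK hεi hω hω']
  set B := halfFrob K e A with hB
  have hBA : halfFrob K e B = A := halfFrob_halfFrob hK A
  -- Terms are grouped so that replacing each conjugate by its argument, which χ does not see, gives
  -- `e2`: the two copies of A⁹ cancel and ω + ω² = 1 merges the A⁸Ā terms.
  have e1 : α * (δ * (A + ω ^ 2 * B) ^ 3) ^ 3 + β * (δ * (A * B * (ω ^ 2 * A + ω * B)))
      = α * δ ^ 3 * A ^ 9 + halfFrob K e (α * δ ^ 3 * A ^ 9) + α * δ ^ 3 * ω ^ 2 * A ^ 8 * B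
        + halfFrob K e (α * δ ^ 3 * ω * A ^ 8 * B)
        + (δ * ω ^ 2 * β * A ^ 2 * B + halfFrob K e (δ * ω * halfFrob K e β * A ^ 2 * B)) := by
    simp only [map_mul, map_pow, hω', hεi, hα, hBA, halfFrob_halfFrob hK, ← hB]
    grind
  have e2 : α * δ ^ 3 * A ^ 8 * B + δ * (ω ^ 2 * β + ω * halfFrob K e β) * A ^ 2 * B
      = α * δ ^ 3 * A ^ 9 + α * δ ^ 3 * A ^ 9 + α * δ ^ 3 * ω ^ 2 * A ^ 8 * B
        + α * δ ^ 3 * ω * A ^ 8 * B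
        + (δ * ω ^ 2 * β * A ^ 2 * B + δ * ω * halfFrob K e β * A ^ 2 * B) := by
    grind
  rw [e1, e2]
  simp only [traceChar_add, traceChar_halfFrob]

variable [DecidableEq K]

/-- The usual squaring of a quadratic Gauss sum gives q² times the sum of χ∘Q over the radical. The
invariance of Q under cube roots of unity makes χ∘Q trivial there, so the sum never vanishes. -/
theorem quadSum_sq {e : ℕ} (hK : Fintype.card K = (2 ^ e) ^ 2) {ω a : K}
    (hω : ω ^ 2 + ω + 1 = 0) (hω' : halfFrob K e ω = ω) (ha : halfFrob K e a = a) (δ : K) :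
    quadSum e a δ ^ 2 = (2 ^ e) ^ 2 * ((Finset.univ.filter fun y : K =>
      a ^ 8 * y ^ 64 + halfFrob K e δ ^ 8 * y ^ 16 + δ ^ 4 * y ^ 4 + a * y = 0).card : ℤ) := by
  have h2 : (2 : K) = 0 := CharTwo.two_eq_zero
  set Q : K → K := fun x => a * x ^ 8 * halfFrob K e x + δ * x ^ 2 * halfFrob K e x with hQ
  set l : K → K := fun y =>
    a ^ 8 * y ^ 64 + halfFrob K e δ ^ 8 * y ^ 16 + δ ^ 4 * y ^ 4 + a * y with hl
  -- Frobenius powers inside the trace bring every x to the common power x⁸, which again runs over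
  -- all of K.
  have polar (x y : K) : traceChar (Q (x + y)) =
      traceChar (Q x) * traceChar (Q y) * traceChar (x ^ 8 * l (halfFrob K e y)) := by
    set x' := halfFrob K e x with hx
    set y' := halfFrob K e y with hy
    have hx' : halfFrob K e x' = x := halfFrob_halfFrob hK x
    have hy' : halfFrob K e y' = y := halfFrob_halfFrob hK y
    have p8 (u v : K) : (u + v) ^ 8 = u ^ 8 + v ^ 8 := by
      simpa using add_pow_char_pow (p := 2) (n := 3) u v
    have e1 : Q (x + y) = Q x + Q y + (a * x ^ 8 * y' + halfFrob K e (a * y' ^ 8 * x)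
        + (δ * x ^ 2 * y' + halfFrob K e (halfFrob K e δ * y' ^ 2 * x))) := by
      simp only [hQ, map_mul, map_add, map_pow, ha, hy', halfFrob_halfFrob hK, ← hx, ← hy, p8,
        CharTwo.add_sq]
      ring
    have e2 : x ^ 8 * l y' = a * x ^ 8 * y' + (a * y' ^ 8 * x) ^ 2 ^ 3
        + ((δ * x ^ 2 * y') ^ 2 ^ 2 + (halfFrob K e δ * y' ^ 2 * x) ^ 2 ^ 3) := by
      simp only [hl]; ring
    rw [e1, e2]
    simp only [traceChar_add, traceChar_halfFrob, traceChar_pow_two_pow]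
  have hrad (y : K) (hy : l (halfFrob K e y) = 0) : traceChar (Q y) = 1 := by
    have h3 : ω ^ 3 = 1 := by linear_combination (ω - 1) * hω
    have hinv (c : K) (hc : c ^ 3 = 1) (hc' : halfFrob K e c = c) (y : K) : Q (c * y) = Q y := by
      simp only [hQ, map_mul, hc']
      linear_combination (a * y ^ 8 * halfFrob K e y * (c ^ 6 + c ^ 3 + 1)
        + δ * y ^ 2 * halfFrob K e y) * hc
    -- Here ωy + y = ω²y, and Q takes the same value at y, ωy and ω²y; so χ(Q(y)) = χ(Q(y))² = 1.
    have h := polar (ω * y) y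
    rw [hy, mul_zero, traceChar_zero, mul_one, hinv ω h3 hω', traceChar_mul_self,
      show ω * y + y = ω ^ 2 * y by grind, hinv (ω ^ 2) (by linear_combination (ω ^ 3 + 1) * h3)
      (by rw [map_pow, hω'])] at h
    exact h
  have hmul (x : K) : quadSum e a δ * traceChar (Q x)
      = ∑ y, traceChar (Q y) * traceChar (x ^ 8 * l (halfFrob K e y)) := by
    have := Fintype.sum_equiv (Equiv.addLeft x) (fun y => traceChar (Q (x + y)))
      (fun y => traceChar (Q y)) (fun y => by simp)
    rw [quadSum, ← this, Finset.sum_mul]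
    refine Finset.sum_congr rfl fun y _ => ?_
    rw [polar]
    linear_combination (traceChar (Q y) * traceChar (x ^ 8 * l (halfFrob K e y)))
      * traceChar_mul_self (Q x)
  have h8 : Function.Bijective fun x : K => x ^ 8 := by
    refine Finite.injective_iff_bijective.1 fun x y h => ?_
    exact (iterateFrobenius K 2 3).injective (by simpa [iterateFrobenius_def] using h)
  have hsum (c : K) : ∑ x : K, traceChar (x ^ 8 * c) =
      if c = 0 then (Fintype.card K : ℤ) else 0 := by
    rw [← sum_traceChar_mul]
    exact Fintype.sum_bijective _ h8 _ _ fun x => rfl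
  calc quadSum e a δ ^ 2 = ∑ x, quadSum e a δ * traceChar (Q x) := by
        rw [sq, ← Finset.mul_sum]; rfl
    _ = ∑ y, traceChar (Q y) * ∑ x, traceChar (x ^ 8 * l (halfFrob K e y)) := by
        simp only [hmul, Finset.mul_sum]; exact Finset.sum_comm
    _ = ∑ y, if l (halfFrob K e y) = 0 then (Fintype.card K : ℤ) else 0 := by
        refine Finset.sum_congr rfl fun y _ => ?_
        rw [hsum]
        split_ifs with h
        · rw [hrad y h, one_mul]
        · rw [mul_zero]
    _ = ∑ y, if l y = 0 then (Fintype.card K : ℤ) else 0 :=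
        Fintype.sum_bijective _ (halfFrob_bijective e) _ _ fun y => rfl
    _ = _ := by
        rw [← Finset.sum_filter, Finset.sum_const, nsmul_eq_mul, hK, mul_comm]
        push_cast; rfl

end QuadSum

/-! ### Frobenius-twisted matrix products. -/

section FrobProd

variable {K : Type*} [Field K] [CharP K 2]

/-- The entrywise Frobenius power `x ↦ x ^ 2 ^ n` on matrices. -/
noncomputable def frobMat (n : ℕ) : Matrix (Fin 3) (Fin 3) K →+* Matrix (Fin 3) (Fin 3) K :=
  (iterateFrobenius K 2 n).mapMatrix

theorem frobMat_apply (n : ℕ) (M : Matrix (Fin 3) (Fin 3) K) (i j : Fin 3) :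
    frobMat n M i j = M i j ^ 2 ^ n := rfl

theorem frobMat_frobMat (a b : ℕ) (M : Matrix (Fin 3) (Fin 3) K) :
    frobMat a (frobMat b M) = frobMat (a + b) M := by
  ext i j; simp only [frobMat_apply, ← pow_mul, ← pow_add, add_comm]

theorem frobMat_zero (M : Matrix (Fin 3) (Fin 3) K) : frobMat 0 M = M := by
  ext i j; simp [frobMat_apply]

theorem frobMat_transpose (n : ℕ) (M : Matrix (Fin 3) (Fin 3) K) :
    frobMat n M.transpose = (frobMat n M).transpose := rfl

theorem det_frobMat (n : ℕ) (M : Matrix (Fin 3) (Fin 3) K) :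
    (frobMat n M).det = M.det ^ 2 ^ n := by
  rw [← iterateFrobenius_def, RingHom.map_det]; rfl

theorem frobMat_smul_one (n : ℕ) (c : K) :
    frobMat n (c • (1 : Matrix (Fin 3) (Fin 3) K)) = c ^ 2 ^ n • 1 := by
  ext i j
  rw [frobMat_apply, Matrix.smul_apply, Matrix.smul_apply, smul_eq_mul, smul_eq_mul, mul_pow]
  congr 1
  rcases eq_or_ne i j with rfl | h
  · simp
  · simp [h]

/-- The product `φᵏ⁻¹(C) ⋯ φ(C) C`, where `φ(x) = x⁴`. -/
noncomputable def frobProd (C : Matrix (Fin 3) (Fin 3) K) : ℕ → Matrix (Fin 3) (Fin 3) K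
  | 0 => 1
  | k + 1 => frobMat (2 * k) C * frobProd C k

theorem frobProd_succ' (C : Matrix (Fin 3) (Fin 3) K) (k : ℕ) :
    frobProd C (k + 1) = frobMat 2 (frobProd C k) * C := by
  induction k with
  | zero => simp [frobProd, frobMat_zero]
  | succ k ih =>
    conv_lhs => rw [frobProd, ih]
    conv_rhs => rw [frobProd, map_mul, frobMat_frobMat]
    rw [mul_assoc, show 2 * (k + 1) = 2 + 2 * k by ring]

theorem frobProd_frobMat (C : Matrix (Fin 3) (Fin 3) K) (n k : ℕ) :
    frobProd (frobMat n C) k = frobMat n (frobProd C k) := by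
  induction k with
  | zero => simp [frobProd]
  | succ k ih =>
    rw [frobProd, frobProd, map_mul, ih, frobMat_frobMat, frobMat_frobMat, add_comm]

theorem det_frobProd (C : Matrix (Fin 3) (Fin 3) K) (k : ℕ) :
    (frobProd C k).det = C.det ^ (∑ i ∈ Finset.range k, 4 ^ i) := by
  induction k with
  | zero => simp [frobProd]
  | succ k ih =>
    rw [frobProd, Matrix.det_mul, ih, det_frobMat, Finset.sum_range_succ, pow_add, mul_comm,
      pow_mul]
    norm_num

/-- Twisting the one-step identity by successive powers of x ↦ x⁴ makes the product telescope. -/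
theorem frobProd_isometry {C C' S : Matrix (Fin 3) (Fin 3) K}
    (h : C'.transpose * frobMat 2 S * frobMat 3 C = S) (k : ℕ) :
    (frobProd C' k).transpose * frobMat (2 * k) S * frobMat 3 (frobProd C k) = S := by
  induction k with
  | zero => simp [frobProd, frobMat_zero]
  | succ k ih =>
    have h' := congrArg (frobMat (2 * k)) h
    simp only [map_mul, frobMat_frobMat, frobMat_transpose] at h'
    rw [frobProd, frobProd, map_mul, frobMat_frobMat, Matrix.transpose_mul,
      show 2 * (k + 1) = 2 * k + 2 by ring, add_comm 3]
    calc _ = (frobProd C' k).transpose * (((frobMat (2 * k)) C').transpose *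
          (frobMat (2 * k + 2)) S * (frobMat (2 * k + 3)) C) * (frobMat 3) (frobProd C k) := by
          simp only [mul_assoc]
      _ = S := by rw [h', ih]

theorem frobProd_mulVec {C : Matrix (Fin 3) (Fin 3) K} {ε : K} {v : Fin 3 → K}
    (h : C.mulVec v = ε • fun i => v i ^ 4) (k : ℕ) :
    (frobProd C k).mulVec v =
      ε ^ (∑ i ∈ Finset.range k, 4 ^ i) • fun i => v i ^ 4 ^ k := by
  induction k with
  | zero => simp [frobProd]
  | succ k ih =>
    have h' : (frobMat (2 * k) C).mulVec (fun i => v i ^ 4 ^ k)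
        = ε ^ 4 ^ k • fun i => v i ^ 4 ^ (k + 1) := by
      ext i
      have h1 := congrArg (iterateFrobenius K 2 (2 * k)) (congrFun h i)
      rw [RingHom.map_mulVec] at h1
      have h4 : (2 : ℕ) ^ (2 * k) = 4 ^ k := by rw [pow_mul]; norm_num
      have h2 : (⇑(iterateFrobenius K 2 (2 * k)) ∘ v) = fun i => v i ^ 4 ^ k := by
        ext i; simp [iterateFrobenius_def, h4]
      rw [h2] at h1
      refine h1.trans ?_
      simp only [iterateFrobenius_def, h4, Pi.smul_apply, smul_eq_mul, mul_pow, ← pow_mul,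
        pow_succ' 4]
    rw [frobProd, ← Matrix.mulVec_mulVec, ih, Matrix.mulVec_smul, h', smul_smul, ← pow_add,
      Finset.sum_range_succ]

/-- In the cubic det(N + x), the coefficients of x and x² cancel when summed over the three cube
roots of unity, and 3 = 1. -/
theorem det_add_smul_one_sum (N : Matrix (Fin 3) (Fin 3) K) {ρ : K} (hρ : ρ ^ 2 + ρ + 1 = 0) :
    ∑ i : Fin 3, (N + (ρ ^ (i : ℕ)) • 1).det = 1 + N.det := by
  have h2 : (2 : K) = 0 := CharTwo.two_eq_zero
  have h3 : ρ ^ 3 = 1 := by linear_combination (ρ - 1) * hρ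
  obtain ⟨t, u, h⟩ : ∃ t u : K, ∀ x : K, (N + x • 1).det = x ^ 3 + t * x ^ 2 + u * x + N.det := by
    refine ⟨N 0 0 + N 1 1 + N 2 2, N 0 0 * N 1 1 + N 0 0 * N 2 2 + N 1 1 * N 2 2
      - N 0 1 * N 1 0 - N 0 2 * N 2 0 - N 1 2 * N 2 1, fun x => ?_⟩
    simp [Matrix.det_fin_three]
    ring
  simp only [Fin.sum_univ_three, h]
  simp only [Fin.val_zero, Fin.val_one, Fin.val_two, pow_zero, pow_one]
  linear_combination (t * (ρ ^ 2 - ρ + 1) + u) * hρ + (ρ ^ 3 + 2) * h3 + (N.det + 1) * h2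

end FrobProd

/-! ### Descent for semilinear maps. -/

section FixedVector

variable {K : Type*} [Field K] [Fintype K]

/-- A form of Hilbert's Theorem 90 for semilinear maps. -/
theorem exists_fixed_of_semilinear {ι : Type*} {e : ℕ} (hK : Fintype.card K = 4 ^ e)
    (f : (ι → K) →+ (ι → K)) (hf : ∀ (c : K) v, f (c • v) = c ^ 4 • f v) {v : ι → K}
    (hv : v ≠ 0) (hfv : f^[e] v = v) : ∃ w, w ≠ 0 ∧ f w = w := by
  -- Lagrange resolvents: each is fixed, so it suffices that one is nonzero.
  set w : K → ι → K := fun c => ∑ k ∈ Finset.range e, c ^ 4 ^ k • f^[k] v with hw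
  have hfix (c : K) : f (w c) = w c := by
    have h1 : f (w c) = ∑ k ∈ Finset.range e, c ^ 4 ^ (k + 1) • f^[k + 1] v := by
      rw [hw, map_sum]
      refine Finset.sum_congr rfl fun k _ => ?_
      rw [hf, ← pow_mul, ← pow_succ, Function.iterate_succ_apply']
    have h2 := (Finset.sum_range_succ' (fun k => c ^ 4 ^ k • f^[k] v) e).symm.trans
      (Finset.sum_range_succ (fun k => c ^ 4 ^ k • f^[k] v) e)
    rw [hfv, ← hK, FiniteField.pow_card] at h2
    rw [h1]
    simpa using h2
  by_contra! h
  have hw0 (c : K) : w c = 0 := by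
    by_contra h0
    exact h _ h0 (hfix c)
  obtain ⟨j, hj⟩ := Function.ne_iff.1 hv
  have he : 0 < e := by
    have := Fintype.one_lt_card (α := K)
    rcases Nat.eq_zero_or_pos e with rfl | h
    · simp at hK; omega
    · exact h
  -- If all resolvents vanished, this polynomial of degree below |K| would vanish on K, although its
  -- coefficient of X is `v j` ≠ 0.
  set p : K[X] := ∑ k ∈ Finset.range e, C (f^[k] v j) * X ^ 4 ^ k with hp
  have hp0 : p = 0 := by
    refine Polynomial.eq_zero_of_natDegree_lt_card_of_eval_eq_zero p Function.injective_id
      (fun c => ?_) ?_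
    · have := congrFun (hw0 c) j
      simp only [hw, Finset.sum_apply, Pi.smul_apply, smul_eq_mul, Pi.zero_apply] at this
      rw [id, hp, eval_finsetSum, ← this]
      exact Finset.sum_congr rfl fun k _ => by rw [eval_mul, eval_C, eval_pow, eval_X, mul_comm]
    · rw [hK]
      refine lt_of_le_of_lt (natDegree_sum_le_of_forall_le _ _ (n := 4 ^ (e - 1)) fun k hk => ?_)
        (Nat.pow_lt_pow_right (by norm_num) (by omega))
      exact (natDegree_C_mul_X_pow_le _ _).trans (Nat.pow_le_pow_right (by norm_num)
        (by have := Finset.mem_range.1 hk; omega))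
  have h1 : p.coeff 1 = v j := by
    rw [hp, finsetSum_coeff, Finset.sum_eq_single 0]
    · simp
    · intro k _ hk
      rw [coeff_C_mul, coeff_X_pow, if_neg, mul_zero]
      exact (Nat.one_lt_pow hk (by norm_num)).ne
    · intro h0; exact absurd (Finset.mem_range.2 he) h0
  rw [hp0, coeff_zero] at h1
  exact hj h1.symm

end FixedVector

/-! ### Radicals as eigenvectors of the twisted companion product. -/

section CompMat

theorem pow_two_pow_of_pow_four {K : Type*} [Field K] {e : ℕ} (he : Even e) {x : K}
    (hx : x ^ 4 = x) :
    x ^ 2 ^ e = x := by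
  obtain ⟨j, rfl⟩ := he
  induction j with
  | zero => simp
  | succ j ih => rw [show j + 1 + (j + 1) = (j + j) + 2 by ring, pow_add, pow_mul, ih]; exact hx

/-- The companion matrix of the linearized polynomial `α⁸ y⁶⁴ + γ'⁸ y¹⁶ + γ⁴ y⁴ + α y`. -/
def compMat {K : Type*} [Field K] (α γ γ' : K) : Matrix (Fin 3) (Fin 3) K :=
  !![0, 1, 0; 0, 0, 1; α⁻¹ ^ 7, γ ^ 4 * α⁻¹ ^ 8, γ' ^ 8 * α⁻¹ ^ 8]

/-- The Gram matrix of the sesquilinear form preserved by the companion matrix. -/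
def gramMat {K : Type*} [Field K] (α γ γ' : K) : Matrix (Fin 3) (Fin 3) K :=
  !![α, 0, 0; γ' ^ 4, α ^ 4, 0; γ ^ 8, γ' ^ 16, α ^ 16]

theorem det_compMat {K : Type*} [Field K] (α γ γ' : K) : (compMat α γ γ').det = α⁻¹ ^ 7 := by
  simp [compMat, Matrix.det_fin_three]

theorem det_gramMat {K : Type*} [Field K] (α γ γ' : K) : (gramMat α γ γ').det = α ^ 21 := by
  simp [gramMat, Matrix.det_fin_three]; ring

variable {K : Type*} [Field K] [CharP K 2]

theorem frobMat_compMat {α γ γ' : K} {e : ℕ} (hα : halfFrob K e α = α)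
    (hγ : halfFrob K e γ = γ') (hγ' : halfFrob K e γ' = γ) :
    frobMat e (compMat α γ γ') = compMat α γ' γ := by
  rw [halfFrob_apply] at hα hγ hγ'
  have h (x : K) (n : ℕ) : (x ^ n) ^ 2 ^ e = (x ^ 2 ^ e) ^ n := by
    rw [← pow_mul, ← pow_mul, mul_comm]
  ext i j
  rw [frobMat_apply]
  fin_cases i <;> fin_cases j <;> simp [compMat, mul_pow, h, hα, hγ, hγ']

/-- This is the one-step identity that makes N an isometry between its conjugate and its x ↦ x⁸
twist. -/
theorem compMat_isometry {α : K} (hα : α ≠ 0) (γ γ' : K) :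
    (compMat α γ' γ).transpose * frobMat 2 (gramMat α γ γ') * frobMat 3 (compMat α γ γ')
      = gramMat α γ γ' := by
  have h2 : (2 : K) = 0 := CharTwo.two_eq_zero
  have e2 : frobMat 2 (gramMat α γ γ')
      = !![α ^ 4, 0, 0; γ' ^ 16, α ^ 16, 0; γ ^ 32, γ' ^ 64, α ^ 64] := by
    ext i j
    rw [frobMat_apply]
    fin_cases i <;> fin_cases j <;> simp [gramMat, ← pow_mul]
  have e3 : frobMat 3 (compMat α γ γ')
      = !![0, 1, 0; 0, 0, 1; α⁻¹ ^ 56, γ ^ 32 * α⁻¹ ^ 64, γ' ^ 64 * α⁻¹ ^ 64] := by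
    ext i j
    rw [frobMat_apply]
    fin_cases i <;> fin_cases j <;> simp [compMat, mul_pow, ← pow_mul]
  rw [e2, e3]
  ext i j
  fin_cases i <;> fin_cases j <;>
    simp [compMat, gramMat, Matrix.mul_apply, Fin.sum_univ_three] <;> field_simp <;> grind

/-- The polynomial whose roots are the conjugates of the radical of `Tr (a x⁸ x̄ + δ x² x̄)`. -/
def radPoly {K : Type*} [Field K] (a δ δ' y : K) : K := a ^ 8 * y ^ 64 + δ' ^ 8 * y ^ 16 + δ ^ 4 * y ^ 4 + a * y

/-- The vector attached to a root of the radical polynomial. -/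
def rootVec {K : Type*} [Field K] (ε y : K) : Fin 3 → K := ![y, ε * y ^ 4, ε ^ 5 * y ^ 16]

/-- The weights 1, ε, ε⁵ in `rootVec` make the first two coordinates automatic. The matrix does not
involve ε, so the three radicals share it. -/
theorem radPoly_eq_zero_iff {α : K} (hα0 : α ≠ 0) (γ γ' : K) {ε : K} (hε : ε ≠ 0) (y : K) :
    radPoly (α * ε ^ 3) (ε * γ) (ε * γ') y = 0 ↔
      (compMat α γ γ').mulVec (rootVec ε y) = ε • fun i => rootVec ε y i ^ 4 := by
  have h2 : (2 : K) = 0 := CharTwo.two_eq_zero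
  have h : radPoly (α * ε ^ 3) (ε * γ) (ε * γ') y = ε ^ 3 *
      (α ^ 8 * ε ^ 21 * y ^ 64 + γ' ^ 8 * ε ^ 5 * y ^ 16 + γ ^ 4 * ε * y ^ 4 + α * y) := by
    simp only [radPoly]; ring
  rw [h, mul_eq_zero, or_iff_right (pow_ne_zero _ hε), funext_iff, Fin.forall_fin_succ,
    Fin.forall_fin_two]
  simp [compMat, rootVec, Matrix.mulVec, dotProduct, Fin.sum_univ_three]
  rw [and_iff_right (by ring)]
  have h3 : (α ^ 7)⁻¹ * y + γ ^ 4 * (α ^ 8)⁻¹ * (ε * y ^ 4) + γ' ^ 8 * (α ^ 8)⁻¹ * (ε ^ 5 * y ^ 16)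
      = (α ^ 8)⁻¹ * (α * y + γ ^ 4 * ε * y ^ 4 + γ' ^ 8 * ε ^ 5 * y ^ 16) := by
    field_simp
  rw [h3, inv_mul_eq_iff_eq_mul₀ (pow_ne_zero _ hα0)]
  constructor <;> intro h4
  · linear_combination h4 - α ^ 8 * ε ^ 21 * y ^ 64 * h2
  · linear_combination h4 + α ^ 8 * ε ^ 21 * y ^ 64 * h2

variable [Fintype K]

theorem frobMat_eq_self {e : ℕ} (hK : Fintype.card K = (2 ^ e) ^ 2)
    (M : Matrix (Fin 3) (Fin 3) K) : frobMat (2 * e) M = M := by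
  ext i j
  rw [frobMat_apply, mul_comm, pow_mul, ← hK, FiniteField.pow_card]

/-- Write M⁽⁸⁾ for the entrywise eighth power. The isometry N̄ᵀ S N⁽⁸⁾ = S gives N̄ᵀ S (N + ρ)⁽⁸⁾ =
ρ² (N̄ + ρ)ᵀ S. In determinants the conjugation disappears because det N and det(N + ρ) lie in 𝔽₄.
-/
theorem det_frobProd_mul_sq {e : ℕ} (he : Even e) (hK : Fintype.card K = (2 ^ e) ^ 2)
    {α γ γ' ρ : K} (hα0 : α ≠ 0) (hα : halfFrob K e α = α) (hγ : halfFrob K e γ = γ')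
    (hγ' : halfFrob K e γ' = γ) (hρ : ρ ^ 3 = 1)
    (hd : (frobProd (compMat α γ γ') e).det ^ 3 = 1) :
    (frobProd (compMat α γ γ') e).det * (frobProd (compMat α γ γ') e + ρ • 1).det ^ 2
      = (frobProd (compMat α γ γ') e + ρ • 1).det := by
  set C := compMat α γ γ' with hC
  set S := gramMat α γ γ' with hS
  set N := frobProd C e with hN
  set P := (N + ρ • (1 : Matrix (Fin 3) (Fin 3) K)).det with hP
  have hρ4 : ρ ^ 4 = ρ := by rw [pow_succ, hρ, one_mul]
  have hd4 : N.det ^ 4 = N.det := by rw [pow_succ, hd, one_mul]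
  have hCdet : C.det ≠ 0 := by
    rw [hC, det_compMat]; exact pow_ne_zero _ (inv_ne_zero hα0)
  have hSdet : S.det ≠ 0 := by rw [hS, det_gramMat]; exact pow_ne_zero _ hα0
  -- The product of e + 1 twists is peeled from either end; the e-th power of x ↦ x⁴ is the identity
  -- on K.
  have hcomm : frobMat 2 N * C = C * N := by
    rw [hN, ← frobProd_succ', frobProd, frobMat_eq_self hK]
  have hP4 : P ^ 4 = P := by
    have h1 : frobMat 2 (N + ρ • 1) * C = C * (N + ρ • 1) := by
      rw [map_add, frobMat_smul_one, add_mul, mul_add, hcomm]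
      simp [hρ4]
    have h2 := congrArg Matrix.det h1
    rw [Matrix.det_mul, Matrix.det_mul, det_frobMat, mul_comm] at h2
    exact mul_left_cancel₀ hCdet h2
  have hiso : (frobMat e N).transpose * S * frobMat 3 N = S := by
    have h := frobProd_isometry (compMat_isometry hα0 γ γ') e
    rwa [← frobMat_compMat hα hγ hγ', frobProd_frobMat, frobMat_eq_self hK] at h
  have hρρ : ρ * ρ ^ 2 = 1 := by rw [← hρ]; ring
  have h1 : (frobMat e N).transpose * S * frobMat 3 (N + ρ • 1)
      = ρ ^ 2 • ((frobMat e (N + ρ • 1)).transpose * S) := by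
    have h8 : ρ ^ 2 ^ 3 = ρ ^ 2 := by
      rw [show 2 ^ 3 = 4 * 2 by norm_num, pow_mul, hρ4]
    rw [map_add, map_add, frobMat_smul_one, frobMat_smul_one, mul_add, hiso,
      pow_two_pow_of_pow_four he hρ4, h8, Matrix.transpose_add, Matrix.transpose_smul,
      Matrix.transpose_one, add_mul, smul_add, Matrix.mul_smul, mul_one, Matrix.smul_mul, one_mul,
      smul_smul, mul_comm (ρ ^ 2), hρρ, one_smul, add_comm]
  have h2 := congrArg Matrix.det h1
  rw [Matrix.det_mul, Matrix.det_mul, Matrix.det_smul, Matrix.det_mul, Matrix.det_transpose,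
    Matrix.det_transpose, det_frobMat, det_frobMat, det_frobMat, pow_two_pow_of_pow_four he hd4,
    ← hP, pow_two_pow_of_pow_four he hP4, Fintype.card_fin,
    show P ^ 2 ^ 3 = P ^ 2 by rw [show 2 ^ 3 = 4 * 2 by norm_num, pow_mul, hP4],
    show (ρ ^ 2) ^ 3 = 1 by rw [← pow_mul, mul_comm, pow_mul, hρ, one_pow]] at h2
  exact mul_left_cancel₀ hSdet (by linear_combination h2)

theorem frobProd_mulVec_rootVec {e : ℕ} (hK : Fintype.card K = (2 ^ e) ^ 2) {α : K} (hα0 : α ≠ 0)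
    (γ γ' : K) {ε : K} (hε : ε ≠ 0) {y : K}
    (hy : radPoly (α * ε ^ 3) (ε * γ) (ε * γ') y = 0) :
    (frobProd (compMat α γ γ') e).mulVec (rootVec ε y) =
      ε ^ (∑ i ∈ Finset.range e, 4 ^ i) • rootVec ε y := by
  rw [frobProd_mulVec ((radPoly_eq_zero_iff hα0 γ γ' hε y).1 hy)]
  congr 1
  ext i
  rw [show 4 ^ e = Fintype.card K by rw [hK, ← pow_mul, mul_comm, pow_mul]; norm_num,
    FiniteField.pow_card]

/-- Fixed vectors of w ↦ εC⁻¹w⁽⁴⁾, with entrywise fourth power, are exactly the `rootVec`s of roots.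
An eigenvector of N for this eigenvalue is fixed by the e-th iterate, so descent produces a nonzero
fixed vector. -/
theorem exists_root_of_eigenvector {e : ℕ} (hK : Fintype.card K = (2 ^ e) ^ 2) {α : K}
    (hα0 : α ≠ 0) (γ γ' : K) {ε : K} (hε : ε ≠ 0) {v : Fin 3 → K} (hv : v ≠ 0)
    (h : (frobProd (compMat α γ γ') e).mulVec v = ε ^ (∑ i ∈ Finset.range e, 4 ^ i) • v) :
    ∃ y, y ≠ 0 ∧ radPoly (α * ε ^ 3) (ε * γ) (ε * γ') y = 0 := by
  set C := compMat α γ γ' with hC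
  have hCdet : C.det ≠ 0 := by
    rw [hC, det_compMat]; exact pow_ne_zero _ (inv_ne_zero hα0)
  have hK4 : Fintype.card K = 4 ^ e := by rw [hK, ← pow_mul, mul_comm, pow_mul]; norm_num
  have hCinv : C * C⁻¹ = 1 := Matrix.mul_nonsing_inv _ (isUnit_iff_ne_zero.2 hCdet)
  let f : (Fin 3 → K) →+ (Fin 3 → K) :=
    { toFun := fun w => ε • C⁻¹.mulVec fun i => w i ^ 4
      map_zero' := by
        have : (fun i : Fin 3 => (0 : Fin 3 → K) i ^ 4) = 0 := by ext; simp
        rw [this]; simp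
      map_add' := fun u w => by
        have : (fun i => (u + w) i ^ 4) = (fun i => u i ^ 4) + fun i => w i ^ 4 := by
          ext i
          simpa using add_pow_char_pow (p := 2) (n := 2) (u i) (w i)
        rw [this, Matrix.mulVec_add, smul_add] }
  have hf (w : Fin 3 → K) : f w = ε • C⁻¹.mulVec fun i => w i ^ 4 := rfl
  have hCf (w : Fin 3 → K) : C.mulVec (f w) = ε • fun i => w i ^ 4 := by
    rw [hf, Matrix.mulVec_smul, Matrix.mulVec_mulVec, hCinv, Matrix.one_mulVec]
  have hiter (k : ℕ) : (frobProd C k).mulVec (f^[k] v) =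
      ε ^ (∑ i ∈ Finset.range k, 4 ^ i) • fun i => v i ^ 4 ^ k := by
    induction k with
    | zero => simp [frobProd]
    | succ k ih =>
      rw [frobProd_succ', ← Matrix.mulVec_mulVec, Function.iterate_succ_apply', hCf,
        Matrix.mulVec_smul]
      have h1 : (frobMat 2 (frobProd C k)).mulVec (fun i => (f^[k] v) i ^ 4)
          = fun i => (frobProd C k).mulVec (f^[k] v) i ^ 4 := by
        ext i
        have := RingHom.map_mulVec (iterateFrobenius K 2 2) (frobProd C k) (f^[k] v) i
        exact this.symm
      rw [h1, ih]
      ext i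
      simp only [Pi.smul_apply, smul_eq_mul, mul_pow, ← pow_mul]
      rw [← mul_assoc, ← pow_succ', ← pow_succ, Finset.sum_range_succ', Finset.sum_mul]
      simp only [pow_succ, pow_zero]
  have hN : (frobProd C e).det ≠ 0 := by rw [det_frobProd]; exact pow_ne_zero _ hCdet
  have hfix : f^[e] v = v := by
    refine Matrix.mulVec_injective_of_isUnit
      ((Matrix.isUnit_iff_isUnit_det _).2 (isUnit_iff_ne_zero.2 hN)) ?_
    rw [hiter, h]
    congr 1
    ext i
    rw [← hK4, FiniteField.pow_card]
  obtain ⟨w, hw0, hw⟩ := exists_fixed_of_semilinear hK4 f (fun c w => by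
    have : (fun i => (c • w) i ^ 4) = c ^ 4 • fun i => w i ^ 4 := by
      ext i; simp [mul_pow]
    rw [hf, hf, this, Matrix.mulVec_smul, smul_comm]) hv hfix
  have hCw := hCf w
  rw [hw] at hCw
  have hw1 := congrFun hCw 0
  have hw2 := congrFun hCw 1
  simp [hC, compMat, Matrix.mulVec, dotProduct, Fin.sum_univ_three] at hw1 hw2
  have hwv : w = rootVec ε (w 0) := by
    ext i
    fin_cases i
    · rfl
    · exact hw1
    · simp only [rootVec]
      simp [hw2, hw1]; ring
  refine ⟨w 0, fun h0 => hw0 ?_, (radPoly_eq_zero_iff hα0 γ γ' hε _).2 (hwv ▸ hCw)⟩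
  rw [hwv, h0]
  ext i; fin_cases i <;> simp [rootVec]

end CompMat

theorem Int.eq_of_sq_eq_two_pow {z : ℤ} {j : ℕ} (h : z ^ 2 = 2 ^ j) (h64 : (2 : ℤ) ^ j ≤ 64) :
    z = 1 ∨ z = -1 ∨ z = 2 ∨ z = -2 ∨ z = 4 ∨ z = -4 ∨ z = 8 ∨ z = -8 := by
  have hj : j ≤ 6 := by
    by_contra! hj
    have := pow_le_pow_right₀ (a := (2 : ℤ)) (by norm_num) (show 7 ≤ j from hj)
    omega
  have h1 : z ≤ 8 := by nlinarith
  have h2 : -8 ≤ z := by nlinarith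
  interval_cases z <;> simp at h ⊢ <;> interval_cases j <;> simp at h

/-- Three distinct eigenvalues in dimension 3 leave only a line for each. Four vectors are
dependent, and applying N twice isolates the coefficients of `u` and `w`, which must vanish. -/
theorem exists_relation_of_eigenvectors {K : Type*} [Field K] {N : Matrix (Fin 3) (Fin 3) K} {r s t : K}
    (hrs : r ≠ s) (hrt : r ≠ t) (hst : s ≠ t) {v₁ v₂ u w : Fin 3 → K}
    (h₁ : N.mulVec v₁ = r • v₁) (h₂ : N.mulVec v₂ = r • v₂)
    (hu : N.mulVec u = s • u) (hw : N.mulVec w = t • w) (hu0 : u ≠ 0) (hw0 : w ≠ 0) :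
    ∃ a b : K, (a ≠ 0 ∨ b ≠ 0) ∧ a • v₁ + b • v₂ = 0 := by
  have hdep : ¬ LinearIndependent K ![v₁, v₂, u, w] := fun h => by
    have := h.fintype_card_le_finrank
    simp at this
  obtain ⟨g, hg, i, hi⟩ := Fintype.not_linearIndependent_iff.1 hdep
  simp only [Fin.sum_univ_four, Matrix.cons_val_zero, Matrix.cons_val_one, Matrix.cons_val] at hg
  have e1 := congrArg N.mulVec hg
  simp only [Matrix.mulVec_add, Matrix.mulVec_smul, h₁, h₂, hu, hw, Matrix.mulVec_zero] at e1
  have e2 := congrArg N.mulVec e1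
  simp only [Matrix.mulVec_add, Matrix.mulVec_smul, h₁, h₂, hu, hw, Matrix.mulVec_zero] at e2
  have c0 (j : Fin 3) := congrFun hg j
  have c1 (j : Fin 3) := congrFun e1 j
  have c2 (j : Fin 3) := congrFun e2 j
  simp only [Pi.add_apply, Pi.smul_apply, smul_eq_mul, Pi.zero_apply] at c0 c1 c2
  have hu' : g 2 = 0 := by
    obtain ⟨j, hj⟩ := Function.ne_iff.1 hu0
    replace hj : u j ≠ 0 := hj
    have : (s - r) * (s - t) * u j * g 2 = 0 := by
      linear_combination c2 j - (r + t) * c1 j + r * t * c0 j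
    simpa [sub_eq_zero, hrs.symm, hst, hj] using this
  have hw' : g 3 = 0 := by
    obtain ⟨j, hj⟩ := Function.ne_iff.1 hw0
    replace hj : w j ≠ 0 := hj
    have : (t - r) * (t - s) * w j * g 3 = 0 := by
      linear_combination c2 j - (r + s) * c1 j + r * s * c0 j
    simpa [sub_eq_zero, hrt.symm, hst.symm, hj] using this
  refine ⟨g 0, g 1, ?_, by simpa [hu', hw'] using hg⟩
  fin_cases i
  · exact Or.inl hi
  · exact Or.inr hi
  · exact absurd hu' hi
  · exact absurd hw' hi

/-! ### Counting roots of the radical polynomial. -/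

section RadCard

variable {K : Type*} [Field K] [Fintype K] [DecidableEq K]

/-- The number of roots of the radical polynomial. -/
def radCard (a δ δ' : K) : ℕ := (Finset.univ.filter fun y : K => radPoly a δ δ' y = 0).card

theorem radCard_le {a : K} (ha : a ≠ 0) (δ δ' : K) : radCard a δ δ' ≤ 64 := by
  set p : K[X] := C (a ^ 8) * X ^ 64 + C (δ' ^ 8) * X ^ 16 + C (δ ^ 4) * X ^ 4 + C a * X with hp
  have hdeg : p.natDegree = 64 := by
    rw [hp]; compute_degree!
  have hp0 : p ≠ 0 := by rintro h; rw [h] at hdeg; simp at hdeg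
  have hsub : (Finset.univ.filter fun y : K => radPoly a δ δ' y = 0) ⊆ p.roots.toFinset := by
    intro y hy
    rw [Multiset.mem_toFinset, mem_roots hp0]
    have hy' := (Finset.mem_filter.1 hy).2
    simpa [hp, radPoly, IsRoot] using hy'
  calc radCard a δ δ' ≤ p.roots.toFinset.card := Finset.card_le_card hsub
    _ ≤ p.roots.card := Multiset.toFinset_card_le _
    _ ≤ 64 := hdeg ▸ p.card_roots'

theorem radCard_eq_one_iff (a δ δ' : K) :
    radCard a δ δ' = 1 ↔ ∀ y, radPoly a δ δ' y = 0 → y = 0 := by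
  have h0 : radPoly a δ δ' 0 = 0 := by simp [radPoly]
  rw [radCard, Finset.card_eq_one]
  constructor
  · rintro ⟨x, hx⟩ y hy
    have h1 : y ∈ ({x} : Finset K) := hx ▸ by simpa using hy
    have h2 : (0 : K) ∈ ({x} : Finset K) := hx ▸ by simpa using h0
    rw [Finset.mem_singleton.1 h1, Finset.mem_singleton.1 h2]
  · intro h
    refine ⟨0, ?_⟩
    ext y
    simp only [Finset.mem_filter, Finset.mem_univ, true_and, Finset.mem_singleton]
    exact ⟨h y, fun hy => hy ▸ h0⟩

end RadCard

/-! ### Size of the radical in terms of eigenvalues of N. -/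

section Radical

variable {K : Type*} [Field K] [CharP K 2]

theorem radPoly_add (a δ δ' x y : K) :
    radPoly a δ δ' (x + y) = radPoly a δ δ' x + radPoly a δ δ' y := by
  have h (n : ℕ) : (x + y) ^ 2 ^ n = x ^ 2 ^ n + y ^ 2 ^ n := add_pow_char_pow ..
  have h2 := h 2
  have h4 := h 4
  have h6 := h 6
  norm_num at h2 h4 h6
  simp only [radPoly, h2, h4, h6]
  ring

theorem mulVec_eq_smul_iff {N : Matrix (Fin 3) (Fin 3) K} {ρ : K} {v : Fin 3 → K} :
    (N + ρ • 1).mulVec v = 0 ↔ N.mulVec v = ρ • v := by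
  rw [Matrix.add_mulVec, Matrix.smul_mulVec, Matrix.one_mulVec, add_eq_zero_iff_eq_neg]
  have : -(ρ • v) = ρ • v := by ext i; exact CharTwo.neg_eq _
  rw [this]

variable [Fintype K] [DecidableEq K]

theorem radCard_eq_two_pow {e : ℕ} (hK : Fintype.card K = (2 ^ e) ^ 2) (a δ δ' : K) :
    ∃ j, radCard a δ δ' = 2 ^ j := by
  let f : K →+ K := AddMonoidHom.mk' (radPoly a δ δ') (radPoly_add a δ δ')
  have h1 : radCard a δ δ' = Nat.card f.ker := by
    rw [radCard, Nat.card_eq_fintype_card, Fintype.card_subtype]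
    congr 1; ext y; simp [f, AddMonoidHom.mem_ker]
  have h2 : Nat.card f.ker ∣ 2 ^ (e * 2) := by
    rw [pow_mul, ← hK, ← Nat.card_eq_fintype_card]; exact f.ker.card_addSubgroup_dvd_card
  obtain ⟨j, -, hj⟩ := (Nat.dvd_prime_pow Nat.prime_two).1 h2
  exact ⟨j, h1.trans hj⟩

theorem radCard_eq_one_iff_det_ne_zero {e : ℕ} (hK : Fintype.card K = (2 ^ e) ^ 2) {α : K}
    (hα0 : α ≠ 0) (γ γ' : K) {ε : K} (hε : ε ≠ 0) :
    radCard (α * ε ^ 3) (ε * γ) (ε * γ') = 1 ↔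
      (frobProd (compMat α γ γ') e + (ε ^ (∑ i ∈ Finset.range e, 4 ^ i)) • 1).det ≠ 0 := by
  rw [radCard_eq_one_iff, ← not_iff_not, not_not, ← Matrix.exists_mulVec_eq_zero_iff]
  push Not
  constructor
  · rintro ⟨y, hy, hy0⟩
    refine ⟨rootVec ε y, fun h => hy0 (congrFun h 0), ?_⟩
    rw [mulVec_eq_smul_iff, frobProd_mulVec_rootVec hK hα0 γ γ' hε hy]
  · rintro ⟨v, hv0, hv⟩
    obtain ⟨y, hy0, hy⟩ := exists_root_of_eigenvector hK hα0 γ γ' hε hv0 (mulVec_eq_smul_iff.1 hv)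
    exact ⟨y, hy, hy0⟩

/-- The eigenspace is a line, so the `rootVec`s of two roots x and y ≠ 0 are dependent. Comparing
the coordinates y and εy⁴ gives (x/y)⁴ = x/y, which has at most four solutions. -/
theorem radCard_le_four {e : ℕ} (hK : Fintype.card K = (2 ^ e) ^ 2) {α : K}
    (hα0 : α ≠ 0) (γ γ' : K) {ε : K} (hε : ε ≠ 0) {s t : K}
    (hs : s ≠ ε ^ (∑ i ∈ Finset.range e, 4 ^ i)) (ht : t ≠ ε ^ (∑ i ∈ Finset.range e, 4 ^ i))
    (hst : s ≠ t) (hs0 : (frobProd (compMat α γ γ') e + s • 1).det = 0)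
    (ht0 : (frobProd (compMat α γ γ') e + t • 1).det = 0) :
    radCard (α * ε ^ 3) (ε * γ) (ε * γ') ≤ 4 := by
  by_cases h1 : radCard (α * ε ^ 3) (ε * γ) (ε * γ') = 1
  · omega
  rw [radCard_eq_one_iff] at h1
  push Not at h1
  obtain ⟨y, hy, hy0⟩ := h1
  obtain ⟨u, hu0, hu⟩ := Matrix.exists_mulVec_eq_zero_iff.2 hs0
  obtain ⟨w, hw0, hw⟩ := Matrix.exists_mulVec_eq_zero_iff.2 ht0
  rw [mulVec_eq_smul_iff] at hu hw
  set p : K[X] := X ^ 4 - X with hp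
  have hdeg : p.natDegree = 4 := by rw [hp]; compute_degree!
  have hp0 : p ≠ 0 := by rintro h; rw [h] at hdeg; simp at hdeg
  have hsub : (Finset.univ.filter fun x : K => radPoly (α * ε ^ 3) (ε * γ) (ε * γ') x = 0) ⊆
      p.roots.toFinset.image (· * y) := by
    intro x hx
    replace hx : radPoly (α * ε ^ 3) (ε * γ) (ε * γ') x = 0 := by simpa using hx
    obtain ⟨a, b, hab, h⟩ := exists_relation_of_eigenvectors hs.symm ht.symm hst
      (frobProd_mulVec_rootVec hK hα0 γ γ' hε hy) (frobProd_mulVec_rootVec hK hα0 γ γ' hε hx)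
      hu hw hu0 hw0
    have h0 : a * y + b * x = 0 := congrFun h 0
    have h4 : a * (ε * y ^ 4) + b * (ε * x ^ 4) = 0 := congrFun h 1
    have hb : b ≠ 0 := by
      rintro rfl
      simp [hy0] at h0
      simp [h0] at hab
    rw [Finset.mem_image]
    refine ⟨x / y, ?_, div_mul_cancel₀ _ hy0⟩
    rw [Multiset.mem_toFinset, mem_roots hp0, IsRoot]
    simp only [hp, eval_sub, eval_pow, eval_X]
    have h5 : b * ε * (x ^ 4 * y - x * y ^ 4) = 0 := by
      linear_combination y * h4 - ε * y ^ 4 * h0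
    have h6 := (mul_eq_zero.1 h5).resolve_left (mul_ne_zero hb hε)
    have h7 : x ^ 4 - x * y ^ 3 = 0 := mul_right_cancel₀ hy0 (by linear_combination h6)
    field_simp
    linear_combination h7
  calc radCard (α * ε ^ 3) (ε * γ) (ε * γ') ≤ _ := Finset.card_le_card hsub
    _ ≤ p.roots.toFinset.card := Finset.card_image_le
    _ ≤ p.roots.card := Multiset.toFinset_card_le _
    _ ≤ 4 := hdeg ▸ p.card_roots'

end Radical

theorem three_mul_geom_sum_four (e : ℕ) : 3 * (∑ i ∈ Finset.range e, 4 ^ i) + 1 = (2 ^ e) ^ 2 := by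
  rw [← pow_mul, mul_comm e, pow_mul]
  induction e with
  | zero => simp
  | succ e ih => rw [Finset.sum_range_succ, pow_succ]; norm_num at ih ⊢; omega

/-! ### Possible values of the Walsh transform. -/

section WalshValues

variable {K : Type*} [Field K] [CharP K 2] [Fintype K]

/-- If `p₀ + p₁ + p₂ = 1 + d`, `d³ = 1` and `d pᵢ² = pᵢ`, then the number of nonzero `pᵢ` is even
for `d = 1` and odd otherwise. -/
theorem parity_of_sum_eq_one_add {K : Type*} [Field K] [CharP K 2] {d p₀ p₁ p₂ : K}
    (hd : d ^ 3 = 1) (h₀ : d * p₀ ^ 2 = p₀) (h₁ : d * p₁ ^ 2 = p₁) (h₂ : d * p₂ ^ 2 = p₂)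
    (hsum : p₀ + p₁ + p₂ = 1 + d) :
    (d ≠ 1 → (p₀ ≠ 0 ∧ p₁ ≠ 0 ∧ p₂ ≠ 0) ∨ (p₀ ≠ 0 ∧ p₁ = 0 ∧ p₂ = 0) ∨
      (p₀ = 0 ∧ p₁ ≠ 0 ∧ p₂ = 0) ∨ (p₀ = 0 ∧ p₁ = 0 ∧ p₂ ≠ 0)) ∧
    (d = 1 → (p₀ = 0 ∧ p₁ = 0 ∧ p₂ = 0) ∨ (p₀ = 0 ∧ p₁ ≠ 0 ∧ p₂ ≠ 0) ∨
      (p₀ ≠ 0 ∧ p₁ = 0 ∧ p₂ ≠ 0) ∨ (p₀ ≠ 0 ∧ p₁ ≠ 0 ∧ p₂ = 0)) := by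
  have h2 : (2 : K) = 0 := CharTwo.two_eq_zero
  have hd0 : d ≠ 0 := by rintro rfl; simp at hd
  have h (p : K) (hp : d * p ^ 2 = p) : p = 0 ∨ p = d ^ 2 := by
    refine or_iff_not_imp_left.2 fun hi => ?_
    have h1 : d * p = 1 := mul_right_cancel₀ hi (by linear_combination hp)
    linear_combination d ^ 2 * h1 - p * hd
  have hd2 : d ^ 2 ≠ 0 := pow_ne_zero 2 hd0
  have hdd : d ≠ 1 → 1 + d = d ^ 2 := fun hd1 => by
    linear_combination sq_add_self_add_one_of_pow_three hd hd1 - d ^ 2 * h2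
  have hdd' : d = 1 → 1 + d = 0 := by rintro rfl; linear_combination h2
  have h1d : d = 1 → d ^ 2 = 1 := by rintro rfl; simp
  constructor
  · intro hd1
    have e1 := hdd hd1
    rcases h p₀ h₀ with rfl | rfl <;> rcases h p₁ h₁ with rfl | rfl <;>
      rcases h p₂ h₂ with rfl | rfl <;> simp [hd0] <;> grind
  · intro hd1
    have e1 := hdd' hd1
    rcases h p₀ h₀ with rfl | rfl <;> rcases h p₁ h₁ with rfl | rfl <;>
      rcases h p₂ h₂ with rfl | rfl <;> simp [hd0] <;> grind

variable [Algebra (ZMod 2) K]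

theorem quadSum_eq {e : ℕ} (hK : Fintype.card K = (2 ^ e) ^ 2) [DecidableEq K] {ω a : K}
    (hω : ω ^ 2 + ω + 1 = 0) (hω' : halfFrob K e ω = ω) (ha0 : a ≠ 0)
    (ha : halfFrob K e a = a) (δ : K) :
    ∃ z : ℤ, quadSum e a δ = 2 ^ e * z ∧ z ^ 2 = radCard a δ (halfFrob K e δ) ∧
      (z = 1 ∨ z = -1 ∨ z = 2 ∨ z = -2 ∨ z = 4 ∨ z = -4 ∨ z = 8 ∨ z = -8) := by
  have h := quadSum_sq hK hω hω' ha δ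
  change _ = _ * (radCard a δ (halfFrob K e δ) : ℤ) at h
  obtain ⟨z, hz⟩ := (Int.pow_dvd_pow_iff two_ne_zero).1 (Dvd.intro _ h.symm)
  have hz2 : z ^ 2 = radCard a δ (halfFrob K e δ) := by
    rw [hz, mul_pow] at h
    exact mul_left_cancel₀ (by positivity) h
  obtain ⟨j, hj⟩ := radCard_eq_two_pow hK a δ (halfFrob K e δ)
  have h64 := radCard_le ha0 δ (halfFrob K e δ)
  rw [hj] at hz2 h64
  refine ⟨z, hz, hj ▸ hz2, Int.eq_of_sq_eq_two_pow (j := j) (by exact_mod_cast hz2)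
    (by exact_mod_cast h64)⟩

/-- The possible values of the sum are `± q`, respectively `0` and `± 2 q`. -/
theorem sum_traceChar_sigmaMap_values {e k : ℕ} (he : Even e) (hk : 2 ^ e = 3 * k + 1)
    (hK : Fintype.card K = (2 ^ e) ^ 2) {m : ℕ} (hm : m = ∑ i ∈ Finset.range e, 4 ^ i) {ε α : K}
    (hε0 : ε ≠ 0) (hεm : ε ^ m ≠ 1) (hε : halfFrob K e ε = ε)
    (hα0 : α ≠ 0) (hα : halfFrob K e α = α) (β : K) :
    ∃ v : ℤ, ∑ x, traceChar (α * x ^ 3 + β * sigmaMap K (2 ^ e) x) = 2 ^ e * v ∧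
      (α ^ m ≠ 1 → Odd v) ∧ (α ^ m = 1 → v = 0 ∨ v = 2 ∨ v = -2) := by
  classical
  have hmK : 3 * m + 1 = Fintype.card K := by rw [hm, hK, three_mul_geom_sum_four]
  set ρ := ε ^ m with hρdef
  have hρ3 : ρ ^ 3 = 1 := by
    rw [hρdef, ← pow_mul, mul_comm, pow_mul, pow_eq_one_of_three_mul hmK hε0]
  have hρ := sq_add_self_add_one_of_pow_three hρ3 hεm
  have hρ' : halfFrob K e ρ = ρ := by rw [hρdef, map_pow, hε]
  have hρ0 : ρ ≠ 0 := pow_ne_zero _ hε0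
  have hρ2 : ρ ^ 2 ≠ 1 := fun h => hεm (by rw [pow_succ, h, one_mul] at hρ3; exact hρ3)
  have hρ12 : ρ ^ 2 ≠ ρ := fun h => hεm (mul_left_cancel₀ hρ0 (by rw [mul_one, ← sq, h]))
  set γ := ρ ^ 2 * β + ρ * halfFrob K e β with hγ
  set γ' := halfFrob K e γ with hγ'
  have hγγ : halfFrob K e γ' = γ := halfFrob_halfFrob hK γ
  set N := frobProd (compMat α γ γ') e with hN
  have hdet : N.det = (α ^ m)⁻¹ ^ 7 := by
    rw [hN, det_frobProd, det_compMat, ← hm, ← pow_mul, mul_comm, pow_mul, inv_pow]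
  have hαm3 : (α ^ m) ^ 3 = 1 := by
    rw [← pow_mul, mul_comm, pow_mul, pow_eq_one_of_three_mul hmK hα0]
  have hdet' : N.det = (α ^ m)⁻¹ := by
    rw [hdet, show 7 = 3 + 3 + 1 by norm_num, pow_add, pow_add, inv_pow, hαm3]; simp
  have hd3 : N.det ^ 3 = 1 := by rw [hdet', inv_pow, hαm3, inv_one]
  have hd1 : N.det = 1 ↔ α ^ m = 1 := by rw [hdet', inv_eq_one]
  have hεi (i : Fin 3) : ε ^ (i : ℕ) ≠ 0 := pow_ne_zero _ hε0
  have hεi' (i : Fin 3) : halfFrob K e (ε ^ (i : ℕ)) = ε ^ (i : ℕ) := by rw [map_pow, hε]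
  have hρi (i : Fin 3) : (ε ^ (i : ℕ)) ^ m = ρ ^ (i : ℕ) := by
    rw [hρdef, ← pow_mul, ← pow_mul, mul_comm]
  set P : Fin 3 → K := fun i => (N + ρ ^ (i : ℕ) • 1).det with hPdef
  have hP (i : Fin 3) : N.det * P i ^ 2 = P i :=
    det_frobProd_mul_sq he hK hα0 hα rfl hγγ
      (by rw [← pow_mul, mul_comm, pow_mul, hρ3, one_pow]) hd3
  obtain ⟨hodd, heven⟩ := parity_of_sum_eq_one_add hd3 (hP 0) (hP 1) (hP 2)
    ((Fin.sum_univ_three P).symm.trans (det_add_smul_one_sum N hρ))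
  have hz (i : Fin 3) := quadSum_eq hK hρ hρ' (a := α * (ε ^ (i : ℕ)) ^ 3)
    (mul_ne_zero hα0 (pow_ne_zero _ (hεi i))) (by rw [map_mul, map_pow, hα, hεi'])
    (ε ^ (i : ℕ) * γ)
  choose z hz1 hz2 hz3 using hz
  simp only [map_mul, hεi', ← hγ'] at hz2
  have hone (i : Fin 3) : P i ≠ 0 ↔ z i ^ 2 = 1 := by
    have := radCard_eq_one_iff_det_ne_zero hK hα0 γ γ' (hεi i)
    rw [← hm, hρi] at this
    rw [hz2, hPdef]
    exact this.symm.trans (by norm_cast)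
  have hpow : ∀ i j : Fin 3, i ≠ j → ρ ^ (i : ℕ) ≠ ρ ^ (j : ℕ) := by
    have h01 : ρ ^ 0 ≠ ρ ^ 1 := by rw [pow_zero, pow_one]; exact hεm.symm
    have h02 : ρ ^ 0 ≠ ρ ^ 2 := by rw [pow_zero]; exact hρ2.symm
    have h12 : ρ ^ 1 ≠ ρ ^ 2 := by rw [pow_one]; exact hρ12.symm
    intro i j hij
    fin_cases i <;> fin_cases j <;> first
      | exact absurd rfl hij
      | exact h01
      | exact h02
      | exact h12
      | exact h01.symm
      | exact h02.symm
      | exact h12.symm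
  have hfour (i j l : Fin 3) (hij : j ≠ i) (hil : l ≠ i) (hjl : j ≠ l) (hj : P j = 0)
      (hl : P l = 0) : z i ^ 2 ≤ 4 := by
    have := radCard_le_four hK hα0 γ γ' (hεi i) (s := ρ ^ (j : ℕ)) (t := ρ ^ (l : ℕ))
      (by rw [← hm, hρi]; exact hpow _ _ hij) (by rw [← hm, hρi]; exact hpow _ _ hil)
      (hpow _ _ hjl) hj hl
    rw [hz2]
    exact_mod_cast this
  have hsum := three_mul_sum_eq_sum_quadSum hk hK hmK hε0 hεm hε hρ hρ' hα β
  simp only [← hγ, hz1] at hsum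
  rw [← Finset.mul_sum, Fin.sum_univ_three] at hsum
  -- As 3 is prime to q, it divides z₀ + z₁ + z₂; the quotient is W/q.
  have hcop : IsCoprime (3 : ℤ) (2 ^ e) := (by norm_num : IsCoprime (3 : ℤ) 2).pow_right
  obtain ⟨v, hv⟩ := hcop.dvd_of_dvd_mul_left (Dvd.intro _ hsum)
  have hz' (i : Fin 3) : (P i ≠ 0 ∧ (z i = 1 ∨ z i = -1)) ∨
      (P i = 0 ∧ (z i = 2 ∨ z i = -2 ∨ z i = 4 ∨ z i = -4 ∨ z i = 8 ∨ z i = -8)) := by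
    by_cases hPi : P i = 0
    · have h1 : z i ^ 2 ≠ 1 := mt (hone i).2 (not_not.2 hPi)
      rcases hz3 i with h | h | h
      · rw [h] at h1; norm_num at h1
      · rw [h] at h1; norm_num at h1
      · exact Or.inr ⟨hPi, h⟩
    · exact Or.inl ⟨hPi, by simpa using (hone i).1 hPi⟩
  have hz'' (i : Fin 3) (hi : z i ^ 2 ≤ 4) : -2 ≤ z i ∧ z i ≤ 2 :=
    abs_le.1 (abs_le_of_sq_le_sq (by linarith) (by norm_num))
  refine ⟨v, by rw [hv] at hsum; linarith, fun hα1 => ?_, fun hα1 => ?_⟩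
  · have h := hodd (mt hd1.1 hα1)
    have h0 := hz' 0
    have h1 := hz' 1
    have h2 := hz' 2
    rw [Int.odd_iff]
    rcases h with ⟨a0, a1, a2⟩ | ⟨a0, a1, a2⟩ | ⟨a0, a1, a2⟩ | ⟨a0, a1, a2⟩ <;>
      simp only [a0, a1, a2, ne_eq, not_true_eq_false, not_false_eq_true, false_and, true_and,
        false_or, or_false] at h0 h1 h2 <;> omega
  · have h := heven (hd1.2 hα1)
    have h0 := hz' 0
    have h1 := hz' 1
    have h2 := hz' 2
    rcases h with ⟨a0, a1, a2⟩ | ⟨a0, a1, a2⟩ | ⟨a0, a1, a2⟩ | ⟨a0, a1, a2⟩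
    -- All three eigenvalues occur, so every zᵢ is ±2, and divisibility by 3 forces the sum to be
    -- ±6.
    · have b0 := hz'' 0 (hfour 0 1 2 (by decide) (by decide) (by decide) a1 a2)
      have b1 := hz'' 1 (hfour 1 0 2 (by decide) (by decide) (by decide) a0 a2)
      have b2 := hz'' 2 (hfour 2 0 1 (by decide) (by decide) (by decide) a0 a1)
      simp only [a0, a1, a2, ne_eq, not_true_eq_false, false_and, true_and,
        false_or] at h0 h1 h2
      omega
    -- Two zᵢ are ±1 and the third is even. The sum is even, at most 10 in size and divisible by 3,
    -- hence 0 or ±6.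
    all_goals
      simp only [a0, a1, a2, ne_eq, not_true_eq_false, not_false_eq_true, false_and, true_and,
        false_or, or_false] at h0 h1 h2
      omega

end WalshValues

/-! ### From moments to multiplicities. -/

theorem card_values_of_sum {K : Type*} [Fintype K] {g : K → ℤ} {c : ℤ} (hc : c ≠ 0)
    (h : ∀ x, g x = 0 ∨ g x = c ∨ g x = -c) {s t : ℤ} (hs : ∑ x, g x = c * s)
    (ht : ∑ x, g x ^ 2 = c ^ 2 * t) :
    2 * (Nat.card {x // g x = c} : ℤ) = t + s ∧ 2 * (Nat.card {x // g x = -c} : ℤ) = t - s ∧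
      (Nat.card {x // g x = 0} : ℤ) = Fintype.card K - t := by
  classical
  have hcc : c ≠ -c := by omega
  have hcard (v : ℤ) : (Nat.card {x // g x = v} : ℤ) = ∑ x, if g x = v then 1 else 0 := by
    rw [Nat.card_eq_fintype_card, Fintype.card_subtype, Finset.sum_boole]
  have e1 : ∑ x, g x = c * (Nat.card {x // g x = c} - Nat.card {x // g x = -c}) := by
    rw [hcard, hcard, ← Finset.sum_sub_distrib, Finset.mul_sum]
    refine Finset.sum_congr rfl fun x _ => ?_
    rcases h x with h | h | h <;> simp [h, hc, hc.symm, hcc, hcc.symm]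
  have e2 : ∑ x, g x ^ 2 = c ^ 2 * (Nat.card {x // g x = c} + Nat.card {x // g x = -c}) := by
    rw [hcard, hcard, ← Finset.sum_add_distrib, Finset.mul_sum]
    refine Finset.sum_congr rfl fun x _ => ?_
    rcases h x with h | h | h <;> simp [h, hc, hc.symm, hcc, hcc.symm]
  have e3 : (Fintype.card K : ℤ) = Nat.card {x // g x = c} + Nat.card {x // g x = -c}
      + Nat.card {x // g x = 0} := by
    rw [hcard, hcard, hcard, ← Finset.sum_add_distrib, ← Finset.sum_add_distrib,
      Fintype.card_eq_sum_ones, Nat.cast_sum]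
    refine Finset.sum_congr rfl fun x _ => ?_
    rcases h x with h | h | h <;> simp [h, hc, hc.symm, hcc, hcc.symm]
  have e4 := mul_left_cancel₀ hc (hs.symm.trans e1)
  have e5 := mul_left_cancel₀ (pow_ne_zero 2 hc) (ht.symm.trans e2)
  omega

/-- Odd squares are at least 1, and here their mean is 1. -/
theorem sq_eq_one_of_odd_of_sum {K : Type*} [Fintype K] {v : K → ℤ} (hv : ∀ x, Odd (v x))
    (h : ∑ x, v x ^ 2 = Fintype.card K) (x : K) : v x = 1 ∨ v x = -1 := by
  have h1 : ∑ x : K, (1 : ℤ) = ∑ x, v x ^ 2 := by rw [h]; simp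
  have hle : ∀ x ∈ Finset.univ, 1 ≤ v x ^ 2 := fun x _ => by
    have : v x ≠ 0 := by
      intro h0; have := hv x; rw [h0] at this; simp at this
    have := sq_pos_of_ne_zero this
    omega
  have := (Finset.sum_eq_sum_iff_of_le hle).1 h1 x (Finset.mem_univ x)
  simpa using this.symm

theorem mainTheorem3 (e q : ℕ) (he : 0 < e) (he2 : Even e) (hq : q = 2 ^ e)
    {F K : Type*} [Field F] [Fintype F] [Field K] [Fintype K]
    [Algebra F K] [Algebra (ZMod 2) K]
    (hF : Fintype.card F = q) (hK : Fintype.card K = q ^ 2)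
    (α : F) (hα : α ≠ 0) :
    Function.Bijective (sigmaMap K q) ∧
    ((¬ ∃ γ : F, γ ^ 3 = α) →
      (walshMult (fAlpha K q α) (q : ℤ) : ℚ) = (q : ℚ) * (q + 1) / 2 ∧
      (walshMult (fAlpha K q α) (-(q : ℤ)) : ℚ) = (q : ℚ) * (q - 1) / 2) ∧
    ((∃ γ : F, γ ^ 3 = α) → e = 2 →
      (walshMult (fAlpha K q α) (2 * (q : ℤ)) : ℚ) = 3 * (q : ℚ) / 4 ∧
      (walshMult (fAlpha K q α) (-2 * (q : ℤ)) : ℚ) = (q : ℚ) / 4 ∧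
      (walshMult (fAlpha K q α) 0 : ℚ) = (q : ℚ) ^ 2 - q) ∧
    ((∃ γ : F, γ ^ 3 = α) → 4 ≤ e →
      (walshMult (fAlpha K q α) (2 * (q : ℤ)) : ℚ) = (q : ℚ) * (q + 2) / 8 ∧
      (walshMult (fAlpha K q α) (-2 * (q : ℤ)) : ℚ) = (q : ℚ) * (q - 2) / 8 ∧
      (walshMult (fAlpha K q α) 0 : ℚ) = 3 * (q : ℚ) ^ 2 / 4) := by
  classical
  have : CharP K 2 := charP_of_injective_algebraMap (algebraMap (ZMod 2) K).injective 2
  obtain ⟨k, hk⟩ : ∃ k, 2 ^ e = 3 * k + 1 := by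
    obtain ⟨j, rfl⟩ := he2
    refine ⟨∑ i ∈ Finset.range j, 4 ^ i, ?_⟩
    rw [three_mul_geom_sum_four, ← pow_mul, mul_two]
  set m := ∑ i ∈ Finset.range e, 4 ^ i with hm
  have hm1 : 3 * m + 1 = q ^ 2 := by rw [hm, hq, three_mul_geom_sum_four]
  -- From 3m = (q - 1)(q + 1) with q - 1 = 3k. Thus x^m = (x^k)² on 𝔽_q*, so being a cube is the
  -- same in 𝔽_q and in K for such x.
  have hmk : m = k * (3 * k + 2) := by rw [hq, hk] at hm1; nlinarith
  have hkF : 3 * k + 1 = Fintype.card F := by rw [hF, hq, hk]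
  have hfix (x : F) : halfFrob K e (algebraMap F K x) = algebraMap F K x := by
    rw [halfFrob_apply, ← map_pow, ← hq, ← hF, FiniteField.pow_card]
  have hpow {x : F} (hx : x ≠ 0) : algebraMap F K x ^ m = 1 ↔ x ^ k = 1 := by
    have h3 : (x ^ k) ^ 3 = 1 := by
      rw [← pow_mul, mul_comm, pow_mul, pow_eq_one_of_three_mul hkF hx]
    have h4 : x ^ m = (x ^ k) ^ 2 := by
      rw [hmk, pow_mul, pow_add, pow_mul, h3, one_pow, one_mul]
    rw [← map_pow, ← map_one (algebraMap F K), (algebraMap F K).injective.eq_iff, h4]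
    constructor
    · intro h; rw [pow_succ, h, one_mul] at h3; exact h3
    · intro h; rw [h, one_pow]
  have hcube : (∃ γ : F, γ ^ 3 = α) ↔ algebraMap F K α ^ m = 1 := by
    rw [hpow hα]
    constructor
    · rintro ⟨γ, rfl⟩
      exact pow_eq_one_of_three_mul hkF (by rintro rfl; simp at hα)
    · exact exists_pow_three_eq hkF
  obtain ⟨ε, hε0, hε1⟩ := exists_pow_ne_one hkF
  have hεK0 : algebraMap F K ε ≠ 0 := (_root_.map_ne_zero _).2 hε0
  have hεm : algebraMap F K ε ^ m ≠ 1 := mt (hpow hε0).1 hε1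
  have hαK0 : algebraMap F K α ≠ 0 := (_root_.map_ne_zero _).2 hα
  have hq0 : (q : ℤ) ≠ 0 := by rw [hq]; positivity
  have hqe : (q : ℤ) = 2 ^ e := by rw [hq]; push_cast; rfl
  have hbij : Function.Bijective (sigmaMap K q) := by
    have h3 : (ε ^ k) ^ 3 = 1 := by
      rw [← pow_mul, mul_comm, pow_mul, pow_eq_one_of_three_mul hkF hε0]
    have hω : algebraMap F K (ε ^ k) ^ 2 + algebraMap F K (ε ^ k) + 1 = 0 := by
      rw [← map_pow, ← map_add, ← map_one (algebraMap F K), ← map_add,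
        sq_add_self_add_one_of_pow_three h3 hε1, map_zero]
    rw [hq] at hm1 hK ⊢
    exact sigmaMap_bijective hk hK (hm1.trans hK.symm) hεK0 hεm (hfix ε) hω (hfix _)
  have hinv (x : K) : sigmaInv K q (sigmaMap K q x) = x :=
    Function.leftInverse_invFun hbij.1 x
  have hσ0 : sigmaMap K q 0 = 0 := by
    have hd : dExp q ≠ 0 := by
      have := three_mul_dExp hk; rw [← hq] at this; omega
    have hq' : q ≠ 0 := by exact_mod_cast hq0
    simp [sigmaMap, sigmaPoly, hd, hq']
  have hf0 : fAlpha K q α 0 = 0 := by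
    have : sigmaInv K q 0 = 0 := by simpa [hσ0] using hinv 0
    simp [fAlpha, this]
  have hwalsh (β : K) : walsh (fAlpha K q α) β =
      ∑ x, traceChar (algebraMap F K α * x ^ 3 + β * sigmaMap K q x) := by
    rw [walsh]
    refine (Fintype.sum_bijective _ hbij _ _ fun x => ?_).symm
    rw [fAlpha, hinv, ← map_add]; rfl
  have hval (β : K) : ∃ v : ℤ, walsh (fAlpha K q α) β = q * v ∧
      (algebraMap F K α ^ m ≠ 1 → Odd v) ∧
      (algebraMap F K α ^ m = 1 → v = 0 ∨ v = 2 ∨ v = -2) := by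
    rw [hwalsh, hqe, hq]
    rw [hq] at hK
    exact sum_traceChar_sigmaMap_values he2 hk hK hm hεK0 hεm (hfix ε) hαK0 (hfix α) β
  choose v hv hodd heven using hval
  have hsum : ∑ β, walsh (fAlpha K q α) β = (q : ℤ) ^ 2 := by
    rw [sum_walsh, hf0, hK]; simp
  have hsum2 : ∑ β, walsh (fAlpha K q α) β ^ 2 = (q : ℤ) ^ 4 := by
    rw [sum_walsh_sq, hK]; push_cast; ring
  have hcubic (h : ∃ γ : F, γ ^ 3 = α) : (4 : ℚ) * walshMult (fAlpha K q α) (2 * (q : ℤ)) =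
      q ^ 2 / 2 + q ∧ (4 : ℚ) * walshMult (fAlpha K q α) (-2 * (q : ℤ)) = q ^ 2 / 2 - q ∧
      (walshMult (fAlpha K q α) 0 : ℚ) = 3 * (q : ℚ) ^ 2 / 4 := by
    obtain ⟨j, hj⟩ : (2 : ℤ) ∣ q := by rw [hqe]; exact dvd_pow_self 2 he.ne'
    have hj' : (q : ℚ) = 2 * j := by exact_mod_cast hj
    -- With j = q/2: q² = 2q·j and q⁴ = (2q)²·j².
    obtain ⟨h1, h2, h3⟩ := card_values_of_sum (g := walsh (fAlpha K q α)) (c := 2 * q)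
      (s := j) (t := j ^ 2) (by omega) (fun β => by
        rw [hv]
        rcases heven β (hcube.1 h) with h | h | h <;> rw [h] <;> simp [mul_comm])
      (by rw [hsum, hj]; ring) (by rw [hsum2, hj]; ring)
    rw [neg_mul, walshMult, walshMult, walshMult, hj']
    rw [hK] at h3
    have h1' := congrArg (Int.cast : ℤ → ℚ) h1
    have h2' := congrArg (Int.cast : ℤ → ℚ) h2
    have h3' := congrArg (Int.cast : ℤ → ℚ) h3
    push_cast at h1' h2' h3'
    refine ⟨by linarith, by linarith, ?_⟩
    rw [h3', hj']; ring
  refine ⟨hbij, fun h => ?_, fun h h2 => ?_, fun h _ => ?_⟩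
  · have hv2 : ∑ β, v β ^ 2 = Fintype.card K := by
      rw [hK]
      have : (q : ℤ) ^ 2 * ∑ β, v β ^ 2 = q ^ 2 * q ^ 2 := by
        rw [Finset.mul_sum, ← pow_add, ← hsum2]
        exact Finset.sum_congr rfl fun β _ => by rw [hv]; ring
      exact_mod_cast mul_left_cancel₀ (pow_ne_zero 2 hq0) this
    have hone := sq_eq_one_of_odd_of_sum (fun β => hodd β (mt hcube.2 h)) hv2
    obtain ⟨h1, h2, -⟩ := card_values_of_sum (g := walsh (fAlpha K q α)) (c := q)
      (s := q) (t := q ^ 2) hq0 (fun β => by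
        rw [hv]
        rcases hone β with h | h <;> rw [h] <;> simp)
      (by rw [hsum]; ring) (by rw [hsum2]; ring)
    rw [walshMult, walshMult]
    have h1' := congrArg (Int.cast : ℤ → ℚ) h1
    have h2' := congrArg (Int.cast : ℤ → ℚ) h2
    push_cast at h1' h2'
    constructor <;> linarith
  -- At q = 4 the general cubic multiplicities coincide with the listed ones.
  · obtain ⟨h1, h2', h3⟩ := hcubic h
    have hq4 : (q : ℚ) = 4 := by rw [hq, h2]; norm_num
    rw [h3]
    rw [hq4] at h1 h2' ⊢
    refine ⟨by linarith, by linarith, by norm_num⟩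
  · obtain ⟨h1, h2', h3⟩ := hcubic h
    refine ⟨by linarith, by linarith, h3⟩
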